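/- Let $n\ge 1$, $1<p<\infty$, $p'=p/(p-1)$, and let $q=ab$ with $a\in L_r(\mathbb R^n)$, $b\in L_s(\mathbb R^n)$, where $0<r,s\le\infty$ are not both $\infty$ and $$\tfrac12-\tfrac1p\le \tfrac1r\le 1-\tfrac1p,\qquad -\tfrac12+\tfrac1p\le\tfrac1s\le\tfrac1p,\qquad \tfrac1r+\tfrac1s<\tfrac2n .$$ Put $M_{\nu,m}(u)=\sup_{x}\int_{|x-y|<1}|u(y)|^m|x-y|^{\nu-n}\,dy$ and assume that $M_{\nu,p'}(a)<\infty$ for some $0<\nu<p'$, that $M_{\mu,p}(b)<\infty$ for some $0<\mu<p$, and that $\int_{|x-y|<1}|q(y)|\,dy\to0$ as $|x|\to\infty$. Let $H_0=-\Delta$ in $L_p(\mathbb R^n)$ with domain $W^2_p(\mathbb R^n)$, let $A,B$ be the operators of multiplication by $a,b$ in $L_p(\mathbb R^n)$ with maximal domains, write $R(z;H_0)=(H_0-z)^{-1}$, and let $Q(z)$ be the bounded extension of $BR(z;H_0)A$. Let $H$ be the Schrödinger operator in $L_p(\mathbb R^n)$, i.e. the closed extension of $H_0+AB$ whose resolvent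 is $$(H-z)^{-1}=R(z;H_0)-\overline{R(z;H_0)A}\,(1+Q(z))^{-1}BR(z;H_0)$$ for $z\in\mathbb C\setminus[0,\infty)$ such that $1+Q(z)$ is boundedly invertible (here $\overline{R(z;H_0)A}$ is the bounded extension of $R(z;H_0)A$). Then every eigenvalue $\lambda=|\lambda|e^{i\theta}\in\mathbb C\setminus[0,\infty)$, $0<\theta<2\pi$, of $H$ satisfies $$|\lambda|^{\alpha-n/2}\le(4\pi)^{-n/2}\,I(n,\alpha,\theta)^{\alpha}\,\|a\|_r^{\alpha}\,\|b\|_s^{\alpha},\qquad \alpha=(r^{-1}+s^{-1})^{-1},$$ where, for $\theta\neq\pi$, $$I(n,\alpha,\theta)=\Bigl(\frac{2}{|\sin\theta|}\Bigr)^{\frac12-\frac1{2\alpha}}\Bigl(\frac{\Gamma(\frac\alpha2+\frac12)\,\Gamma(\alpha-\frac n2)}{\Gamma(\alpha)}\,P^{1/2-\alpha/2}_{n/2-\alpha/2-1/2}(-\cos\theta)\Bigr)^{1/\alpha},$$ and, by continuity, $I(n,\alpha,\pi)=\bigl(\Gamma(\alpha-\frac n2)/\Gamma(\alpha)\bigr)^{1/\alpha}$.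 Here $P^\mu_\nu$ is the associated Legendre function of the first kind on the cut, $$P^\mu_\nu(x)=\frac1{\Gamma(1-\mu)}\Bigl(\frac{1+x}{1-x}\Bigr)^{\mu/2}{}_2F_1\Bigl(-\nu,\nu+1;1-\mu;\frac{1-x}2\Bigr),\qquad -1<x<1 .$$ -/

import Mathlib

open MeasureTheory Filter Topology
open scoped ENNReal SchwartzMap LineDeriv Laplacian

namespace Schrodinger

/-- Euclidean space `ℝⁿ`. -/
abbrev Space (n : ℕ) : Type := EuclideanSpace ℝ (Fin n)

/-- The complex Lebesgue space `L_p(ℝⁿ)`. -/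
abbrev LpC (n : ℕ) (p : ℝ≥0∞) : Type := Lp ℂ p (volume : Measure (Space n))

section Multiplication

variable {n : ℕ} {p : ℝ≥0∞}

theorem mul_coeFn_add (a : Space n → ℂ) (u w : LpC n p) :
    (fun x => a x * (u + w : LpC n p) x) =ᵐ[volume]
      (fun x => a x * u x) + fun x => a x * w x := by
  filter_upwards [Lp.coeFn_add u w] with x hx
  rw [hx, Pi.add_apply, Pi.add_apply, mul_add]

theorem mul_coeFn_smul (a : Space n → ℂ) (c : ℂ) (u : LpC n p) :
    (fun x => a x * (c • u : LpC n p) x) =ᵐ[volume] c • fun x => a x * u x := by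
  filter_upwards [Lp.coeFn_smul c u] with x hx
  rw [hx, Pi.smul_apply, Pi.smul_apply, smul_eq_mul, smul_eq_mul, mul_left_comm]

theorem mul_coeFn_zero (p : ℝ≥0∞) (a : Space n → ℂ) :
    (fun x => a x * (0 : LpC n p) x) =ᵐ[volume] fun _ => (0 : ℂ) := by
  filter_upwards [Lp.coeFn_zero ℂ p (volume : Measure (Space n))] with x hx
  rw [hx, Pi.zero_apply, mul_zero]

theorem toLp_mul_add (a : Space n → ℂ) (u w : LpC n p)
    (hu : MemLp (fun x => a x * u x) p volume) (hw : MemLp (fun x => a x * w x) p volume)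
    (huw : MemLp (fun x => a x * (u + w : LpC n p) x) p volume) :
    huw.toLp = hu.toLp + hw.toLp :=
  (MemLp.toLp_congr huw (hu.add hw) (mul_coeFn_add a u w)).trans (MemLp.toLp_add hu hw)

theorem toLp_mul_smul (a : Space n → ℂ) (c : ℂ) (u : LpC n p)
    (hu : MemLp (fun x => a x * u x) p volume)
    (hcu : MemLp (fun x => a x * (c • u : LpC n p) x) p volume) :
    hcu.toLp = c • hu.toLp := by
  refine Lp.ext ?_
  filter_upwards [hcu.coeFn_toLp, hu.coeFn_toLp, mul_coeFn_smul a c u,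
    Lp.coeFn_smul c hu.toLp] with x h₁ h₂ h₃ h₄
  rw [h₁, h₄, h₃, Pi.smul_apply, Pi.smul_apply, h₂]

/-- The maximal domain `{u ∈ L_p : a u ∈ L_p}` of the multiplication by `a`. -/
noncomputable def mulDomain (p : ℝ≥0∞) (a : Space n → ℂ) : Submodule ℂ (LpC n p) where
  carrier := {u | MemLp (fun x => a x * u x) p volume}
  zero_mem' := MemLp.zero.ae_eq (mul_coeFn_zero p a).symm
  add_mem' := fun {u w} hu hw => (MemLp.add hu hw).ae_eq (mul_coeFn_add a u w).symm
  smul_mem' := fun c u hu => (MemLp.const_smul hu c).ae_eq (mul_coeFn_smul a c u).symm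

theorem mem_mulDomain {a : Space n → ℂ} {u : LpC n p} :
    u ∈ mulDomain p a ↔ MemLp (fun x => a x * u x) p volume := Iff.rfl

/-- The operator of multiplication by `a` in `L_p(ℝⁿ)` with its maximal domain. -/
noncomputable def mulOp (p : ℝ≥0∞) (a : Space n → ℂ) : LpC n p →ₗ.[ℂ] LpC n p where
  domain := mulDomain p a
  toFun :=
    { toFun := fun u => (mem_mulDomain.mp u.2).toLp (fun x => a x * (u : LpC n p) x)
      map_add' := fun u w => toLp_mul_add a u.1 w.1 (mem_mulDomain.mp u.2)
        (mem_mulDomain.mp w.2) (mem_mulDomain.mp (u + w).2)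
      map_smul' := fun c u => toLp_mul_smul a c u.1 (mem_mulDomain.mp u.2)
        (mem_mulDomain.mp (c • u).2) }

end Multiplication

section Operators

variable (n : ℕ) (p : ℝ≥0∞) [Fact (1 ≤ p)]

/-- The embedding of `L_p(ℝⁿ)` into the tempered distributions `𝓢'(ℝⁿ)`. -/
noncomputable abbrev toDistr : LpC n p →L[ℂ] 𝓢'(Space n, ℂ) :=
  Lp.toTemperedDistributionCLM ℂ (volume : Measure (Space n)) p

/-- The `i`-th unit vector of `ℝⁿ`. -/
noncomputable abbrev unitVec {n : ℕ} (i : Fin n) : Space n := EuclideanSpace.basisFun (Fin n) ℝ i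

/-- The Sobolev space `W_p²(ℝⁿ)`: all `u ∈ L_p` whose distributional partial derivatives of order
one and two are functions in `L_p`. -/
noncomputable def sobolevTwo : Submodule ℂ (LpC n p) where
  carrier := {u | (∀ i : Fin n, ∃ v : LpC n p, toDistr n p v = ∂_{unitVec i} (toDistr n p u)) ∧
    ∀ i j : Fin n, ∃ v : LpC n p,
      toDistr n p v = ∂_{unitVec i} (∂_{unitVec j} (toDistr n p u))}
  zero_mem' := ⟨fun _ => ⟨0, by simp only [map_zero, LineDeriv.lineDerivOp_zero]⟩,
    fun _ _ => ⟨0, by simp only [map_zero, LineDeriv.lineDerivOp_zero]⟩⟩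
  add_mem' := by
    rintro u w ⟨hu, hu'⟩ ⟨hw, hw'⟩
    refine ⟨fun i => ?_, fun i j => ?_⟩
    · obtain ⟨v, hv⟩ := hu i
      obtain ⟨v', hv'⟩ := hw i
      exact ⟨v + v', by simp only [map_add, LineDeriv.lineDerivOp_add, hv, hv']⟩
    · obtain ⟨v, hv⟩ := hu' i j
      obtain ⟨v', hv'⟩ := hw' i j
      exact ⟨v + v', by simp only [map_add, LineDeriv.lineDerivOp_add, hv, hv']⟩
  smul_mem' := by
    rintro c u ⟨hu, hu'⟩
    refine ⟨fun i => ?_, fun i j => ?_⟩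
    · obtain ⟨v, hv⟩ := hu i
      exact ⟨c • v, by simp only [map_smul, LineDeriv.lineDerivOp_smul, hv]⟩
    · obtain ⟨v, hv⟩ := hu' i j
      exact ⟨c • v, by simp only [map_smul, LineDeriv.lineDerivOp_smul, hv]⟩

theorem toDistr_injective : Function.Injective (toDistr n p) := by
  have h := Lp.ker_toTemperedDistributionCLM_eq_bot (F := ℂ)
    (μ := (volume : Measure (Space n))) (p := p)
  exact LinearMap.ker_eq_bot.mp h

theorem exists_neg_laplacian (u : sobolevTwo n p) :
    ∃ f : LpC n p, toDistr n p f = -Δ (toDistr n p u) := by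
  choose v hv using fun i : Fin n => u.2.2 i i
  refine ⟨-∑ i, v i, ?_⟩
  rw [TemperedDistribution.laplacian_eq_sum (EuclideanSpace.basisFun (Fin n) ℝ), map_neg, map_sum]
  exact congrArg _ (Finset.sum_congr rfl fun i _ => hv i)

/-- The unperturbed operator `H₀ = -Δ` in `L_p(ℝⁿ)` with domain `W_p²(ℝⁿ)`. -/
noncomputable def freeOp : LpC n p →ₗ.[ℂ] LpC n p where
  domain := sobolevTwo n p
  toFun :=
    { toFun := fun u => (exists_neg_laplacian n p u).choose
      map_add' := fun u w => toDistr_injective n p (by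
        rw [map_add, (exists_neg_laplacian n p (u + w)).choose_spec,
          (exists_neg_laplacian n p u).choose_spec, (exists_neg_laplacian n p w).choose_spec,
          Submodule.coe_add, map_add, ← TemperedDistribution.laplacianCLM_apply, map_add, neg_add,
          TemperedDistribution.laplacianCLM_apply, TemperedDistribution.laplacianCLM_apply])
      map_smul' := fun c u => toDistr_injective n p (by
        rw [RingHom.id_apply, map_smul, (exists_neg_laplacian n p (c • u)).choose_spec,
          (exists_neg_laplacian n p u).choose_spec,
          Submodule.coe_smul, map_smul, ← TemperedDistribution.laplacianCLM_apply, map_smul,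
          smul_neg, TemperedDistribution.laplacianCLM_apply]) }

theorem toDistr_freeOp (u : (freeOp n p).domain) :
    toDistr n p (freeOp n p u) = -Δ (toDistr n p u) :=
  (exists_neg_laplacian n p u).choose_spec

variable {n}

variable {p}

/-- The bounded operator `R` is the resolvent `(T - z)⁻¹` of the operator `T`. -/
def IsResolvent (T : LpC n p →ₗ.[ℂ] LpC n p) (z : ℂ) (R : LpC n p →L[ℂ] LpC n p) : Prop :=
  (∀ f, ∃ h : R f ∈ T.domain, T ⟨R f, h⟩ - z • R f = f) ∧
    ∀ u : T.domain, R (T u - z • (u : LpC n p)) = u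

/-- With `A`, `B` the multiplications by `a`, `b` and `R(z; H₀) = (H₀ - z)⁻¹`, the bounded
operators `R`, `K`, `T`, `Q` are respectively `R(z; H₀)`, `B R(z; H₀)`, the bounded extension of
`R(z; H₀) A`, and the bounded extension `Q(z)` of the bordered resolvent `B R(z; H₀) A`.
(`A` is densely defined, so both extensions are unique.) -/
structure IsBorderedResolvent (a b : Space n → ℂ) (z : ℂ) (R K T Q : LpC n p →L[ℂ] LpC n p) :
    Prop where
  isResolvent : IsResolvent (freeOp n p) z R
  eq_BR : ∀ f, ∃ h : R f ∈ (mulOp p b).domain, mulOp p b ⟨R f, h⟩ = K f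
  extends_RA : ∀ u : (mulOp p a).domain, T u = R (mulOp p a u)
  extends_BRA : ∀ u : (mulOp p a).domain, Q u = K (mulOp p a u)

variable (p)

/-- The graph of the Schrödinger operator `H`: for `z ∈ ℂ ∖ [0, ∞)` such that `Q(z)` exists and
`1 + Q(z)` is boundedly invertible, it is the graph `{(G f, f + z G f)}` of the operator whose
resolvent at `z` is
`G = R(z; H₀) - [R(z; H₀) A] (1 + Q(z))⁻¹ B R(z; H₀)`.
All such `z` give one and the same graph; we take the span over all of them, so that no `z` has to
be singled out. -/
noncomputable def schrodingerGraph (a b : Space n → ℂ) : Submodule ℂ (LpC n p × LpC n p) :=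
  Submodule.span ℂ {x | ∃ z : ℂ, (∀ t : ℝ, 0 ≤ t → z ≠ t) ∧
    ∃ R K T Q : LpC n p →L[ℂ] LpC n p, IsBorderedResolvent a b z R K T Q ∧ IsUnit (1 + Q) ∧
      ∃ f : LpC n p, x.1 = R f - T (Ring.inverse (1 + Q) (K f)) ∧ x.2 = f + z • x.1}

/-- The Schrödinger operator `H` in `L_p(ℝⁿ)`: the closed extension of `H₀ + A B` (that is, of
`-Δ + q` with `q = a b`) defined by means of the bordered resolvent. -/
noncomputable def schrodingerOp (a b : Space n → ℂ) : LpC n p →ₗ.[ℂ] LpC n p :=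
  (schrodingerGraph p a b).toLinearPMap

variable {p}

/-- `lam` is an eigenvalue of the operator `T`. -/
def IsEigenvalue (T : LpC n p →ₗ.[ℂ] LpC n p) (lam : ℂ) : Prop :=
  ∃ u : T.domain, (u : LpC n p) ≠ 0 ∧ T u = lam • (u : LpC n p)

end Operators

/-- The Stummel quantity
`M_{ν, m}(u) = sup_x ∫_{|x - y| < 1} |u(y)|^m |x - y|^(ν - n) dy` in `[0, ∞]`. -/
noncomputable def stummel {n : ℕ} (ν m : ℝ) (u : Space n → ℂ) : ℝ≥0∞ :=
  ⨆ x : Space n, ∫⁻ y in Metric.ball x 1,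
    ENNReal.ofReal (‖u y‖ ^ m) * ENNReal.ofReal (dist x y ^ (ν - n))

/-- The associated Legendre function of the first kind `P_ν^μ(x)` on the cut `-1 < x < 1`
(Ferrers function), with upper index `μ` and lower index `ν`. -/
noncomputable def legendreP (ν μ x : ℝ) : ℝ :=
  ((1 + x) / (1 - x)) ^ (μ / 2) / Real.Gamma (1 - μ) *
    ordinaryHypergeometric (-ν) (ν + 1) (1 - μ) ((1 - x) / 2)

/-- The constant `I(n, α, θ)`; at `θ = π`, where `sin θ = 0`, it is the continuous extension. -/
noncomputable def constI (n : ℕ) (α θ : ℝ) : ℝ :=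
  if θ = Real.pi then (Real.Gamma (α - n / 2) / Real.Gamma α) ^ (1 / α)
  else (2 / |Real.sin θ|) ^ (1 / 2 - 1 / (2 * α)) *
    (Real.Gamma (α / 2 + 1 / 2) * Real.Gamma (α - n / 2) / Real.Gamma α *
      legendreP (n / 2 - α / 2 - 1 / 2) (1 / 2 - α / 2) (-Real.cos θ)) ^ (1 / α)

end Schrodinger

/-! An eigenfunction of $H$ solves $-\Delta u+av=\lambda u$ with $v=bu\in L_p$, in the sense of
distributions. To see this one need not construct $H$: every pair in `schrodingerGraph` lies in the
graph of this weak equation (`weakGraph`), which is single-valued, so the eigenpair lies there too.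

Since $\lambda\notin[0,\infty)$, the symbol $m(\xi)=((2\pi)^2|\xi|^2-\lambda)^{-1}$ is smooth of
temperate growth and $\hat u=-m\,\widehat{av}$. This factors the passage from $v$ back to $v=bu$
into bounded steps: Hölder takes $v\in L_p$ to $av\in L_\beta$, Hausdorff–Young to $L_{\beta'}$,
multiplication by $m\in L_\alpha$ to $L_\gamma$, Hausdorff–Young again to $u\in L_{\gamma'}$, and
multiplication by $b$ to $L_p$. The two-sided bounds on $1/r$ and $1/s$ say exactly that
$1\le\beta,\gamma\le2$. As $v\ne0$, it follows that $1\le\|m\|_\alpha\|a\|_r\|b\|_s$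
(`IsEigenvalue.one_le_eLpNorm_mul`). Hausdorff–Young itself comes from the three lines theorem
between $L_1$ and $L_2$, then duality and density.

It remains to compute
$\|m\|_\alpha^\alpha=(4\pi)^{-n/2}|\lambda|^{n/2-\alpha}I(n,\alpha,\theta)^\alpha$. Polar
coordinates reduce it to $\int_0^\infty t^{n/2-1}(t^2-2t\cos\theta+1)^{-\alpha/2}dt$; a binomial
expansion with Beta integrals gives a ${}_2F_1$ at $(1+\cos\theta)/2$, and Euler's transformation
turns this into the Legendre function (`constI_rpow`). -/

namespace Schrodinger

/-! ### Dominated convergence in $L_q$ and closedness of multiplication operators. -/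

section Dominated

variable {X : Type*} [MeasurableSpace X] {μ : Measure X} {q : ℝ≥0∞}

theorem tendsto_eLpNorm_sub_of_dominated (hq₀ : q ≠ 0) (hq : q ≠ ∞) {F : ℕ → X → ℂ} {f : X → ℂ}
    {G : X → ℝ} (hF : ∀ k, AEStronglyMeasurable (F k) μ) (hf : AEStronglyMeasurable f μ)
    (hG : MemLp G q μ) (hFG : ∀ k, ∀ᵐ x ∂μ, ‖F k x‖ ≤ G x)
    (hlim : ∀ᵐ x ∂μ, Tendsto (fun k => F k x) atTop (𝓝 (f x))) :
    Tendsto (fun k => eLpNorm (F k - f) q μ) atTop (𝓝 0) := by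
  have hq' : 0 < q.toReal := ENNReal.toReal_pos hq₀ hq
  have hfG : ∀ᵐ x ∂μ, ‖f x‖ ≤ G x := by
    filter_upwards [hlim, ae_all_iff.mpr hFG] with x h₁ h₂
    exact le_of_tendsto h₁.norm (Eventually.of_forall h₂)
  have hG2 : MemLp (fun x => 2 * G x) q μ := hG.const_mul 2
  have key : Tendsto (fun k => ∫⁻ x, ‖(F k - f) x‖ₑ ^ q.toReal ∂μ) atTop (𝓝 0) := by
    have h0 : (∫⁻ _ : X, (0 : ℝ≥0∞) ∂μ) = 0 := lintegral_zero
    rw [← h0]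
    refine tendsto_lintegral_of_dominated_convergence' (fun x => ‖2 * G x‖ₑ ^ q.toReal)
      (fun k => (((hF k).sub hf).enorm).pow_const _) (fun k => ?_) ?_ ?_
    · filter_upwards [hFG k, hfG] with x h₁ h₂
      refine ENNReal.rpow_le_rpow (enorm_le_iff_norm_le.mpr ?_) hq'.le
      have h₃ : 0 ≤ G x := (norm_nonneg _).trans h₁
      rw [Real.norm_of_nonneg (by positivity)]
      calc ‖(F k - f) x‖ ≤ ‖F k x‖ + ‖f x‖ := norm_sub_le _ _
        _ ≤ 2 * G x := by linarith
    · exact (lintegral_rpow_enorm_lt_top_of_eLpNorm_lt_top hq₀ hq hG2.2).ne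
    · filter_upwards [hlim] with x hx
      have h₁ : Tendsto (fun k => ‖F k x - f x‖ₑ) atTop (𝓝 0) := by
        have := (hx.sub_const (f x)).enorm
        simpa using this
      have h₂ := (ENNReal.continuous_rpow_const (y := q.toReal)).tendsto 0 |>.comp h₁
      rw [ENNReal.zero_rpow_of_pos hq'] at h₂
      exact h₂
  have h₂ := (ENNReal.continuous_rpow_const (y := 1 / q.toReal)).tendsto 0 |>.comp key
  rw [ENNReal.zero_rpow_of_pos (by positivity)] at h₂
  refine h₂.congr fun k => ?_
  rw [eLpNorm_eq_lintegral_rpow_enorm_toReal hq₀ hq]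
  rfl

/-- Multiplication by $b$ is a closed operator: along a common subsequence both sides converge
almost everywhere, so the relation passes to the limit. -/
theorem ae_eq_mul_of_tendsto {Y : Type*} [MeasurableSpace Y] {μ : Measure Y}
    [Fact (1 ≤ q)] {b : Y → ℂ} {u w : ℕ → Lp ℂ q μ} {u₀ w₀ : Lp ℂ q μ}
    (hu : Tendsto u atTop (𝓝 u₀)) (hw : Tendsto w atTop (𝓝 w₀))
    (h : ∀ k, w k =ᵐ[μ] fun x => b x * u k x) : w₀ =ᵐ[μ] fun x => b x * u₀ x := by
  obtain ⟨φ, hφ, h₁⟩ := (tendstoInMeasure_of_tendsto_Lp hu).exists_seq_tendsto_ae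
  have hw' := hw.comp hφ.tendsto_atTop
  obtain ⟨ψ, hψ, h₂⟩ := (tendstoInMeasure_of_tendsto_Lp hw').exists_seq_tendsto_ae
  filter_upwards [h₁, h₂, ae_all_iff.mpr h] with x hx₁ hx₂ hx
  refine tendsto_nhds_unique hx₂ ?_
  refine ((hx₁.comp hψ.tendsto_atTop).const_mul (b x)).congr fun k => ?_
  exact (hx _).symm

end Dominated

/-! ### From the bordered resolvent to the weak eigenvalue equation. -/

section Graph

variable {n : ℕ} {p β r : ℝ≥0∞}

/-- Cutting $v$ off to $\{|a|\le k\}$ makes $av$ bounded by $k|v|$, and dominated convergence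
recovers $v$. This density lets identities for `T` and `Q`, given only on the domain of $A$, extend
to all of $L_p$. -/
theorem exists_seq_mulDomain_tendsto [Fact (1 ≤ p)] (hp : p ≠ ∞) {a : Space n → ℂ}
    (ha : AEStronglyMeasurable a volume) (v : LpC n p) :
    ∃ w : ℕ → LpC n p, (∀ k, w k ∈ mulDomain p a) ∧ Tendsto w atTop (𝓝 v) := by
  have hp₀ : p ≠ 0 := (zero_lt_one.trans_le Fact.out).ne'
  set a' := ha.mk a with ha'
  have hm : ∀ k : ℕ, MeasurableSet {x | ‖a' x‖ ≤ k} := fun k =>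
    measurableSet_le ha.stronglyMeasurable_mk.norm.measurable measurable_const
  have hmem : ∀ k : ℕ, MemLp (Set.indicator {x | ‖a' x‖ ≤ k} v) p volume := fun k =>
    (Lp.memLp v).indicator (hm k)
  refine ⟨fun k => (hmem k).toLp, fun k => ?_, ?_⟩
  · rw [mem_mulDomain]
    have h₁ : MemLp (fun x => a' x * Set.indicator {x | ‖a' x‖ ≤ k} v x) p volume := by
      refine MemLp.of_le_mul (c := k) (Lp.memLp v)
        (ha.stronglyMeasurable_mk.aestronglyMeasurable.mul (hmem k).1) (Eventually.of_forall ?_)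
      intro x
      by_cases hx : ‖a' x‖ ≤ k
      · rw [Set.indicator_of_mem (by exact hx), norm_mul]
        gcongr
      · rw [Set.indicator_of_notMem (by exact hx), mul_zero, norm_zero]
        positivity
    refine h₁.ae_eq ?_
    filter_upwards [ha.ae_eq_mk, (hmem k).coeFn_toLp] with x h₁ h₂
    rw [h₂, h₁]
  · rw [Lp.tendsto_Lp_iff_tendsto_eLpNorm']
    have h := tendsto_eLpNorm_sub_of_dominated hp₀ hp (fun k => (hmem k).1) (Lp.memLp v).1
      (Lp.memLp v).norm (fun k => Eventually.of_forall fun x => norm_indicator_le_norm_self _ _)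
      (Eventually.of_forall fun x => ?_)
    · refine h.congr fun k => eLpNorm_congr_ae ?_
      filter_upwards [(hmem k).coeFn_toLp] with x hx
      simp only [Pi.sub_apply, hx]
    · obtain ⟨N, hN⟩ := exists_nat_ge ‖a' x‖
      refine tendsto_const_nhds.congr' ?_
      filter_upwards [eventually_ge_atTop N] with k hk
      rw [Set.indicator_of_mem]
      exact hN.trans (by exact_mod_cast hk)

variable [Fact (1 ≤ p)] [Fact (1 ≤ β)] [ENNReal.HolderTriple r p β] {a b : Space n → ℂ}

/-- Two functions, possibly in different Lebesgue spaces, that define the same tempered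
distribution are equal almost everywhere. -/
theorem ae_eq_of_toDistr_eq (f : LpC n p) (g : LpC n β) (h : toDistr n p f = toDistr n β g) :
    f =ᵐ[volume] g := by
  refine ae_eq_of_integral_contDiff_smul_eq ((Lp.memLp f).locallyIntegrable Fact.out)
    ((Lp.memLp g).locallyIntegrable Fact.out) fun φ hφ hc => ?_
  have hg₁ : HasCompactSupport (Complex.ofRealCLM ∘ φ) := hc.comp_left rfl
  have hg₂ : ContDiff ℝ ((⊤ : ℕ∞) : WithTop ℕ∞) (Complex.ofRealCLM ∘ φ) := by fun_prop
  have := DFunLike.congr_fun h (hg₁.toSchwartzMap hg₂)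
  simpa using this

theorem IsResolvent.toDistr_apply {z : ℂ} {R : LpC n p →L[ℂ] LpC n p}
    (h : IsResolvent (freeOp n p) z R) (f : LpC n p) :
    -Δ (toDistr n p (R f)) = toDistr n p (f + z • R f) := by
  obtain ⟨hR, hf⟩ := h.1 f
  have h₁ := toDistr_freeOp n p ⟨R f, hR⟩
  rw [← h₁]
  congr 1
  exact sub_eq_iff_eq_add.mp hf

/-- On the domain of $A$ this is the resolvent equation for $R(z;H_0)$ applied to $av$. Both sides
depend continuously on $v$ as tempered distributions, because $av$ still makes sense in $L_\beta$,
so density finishes. -/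
theorem IsBorderedResolvent.toDistr_RA {z : ℂ} {R K T Q : LpC n p →L[ℂ] LpC n p} (hp : p ≠ ∞)
    (ha : MemLp a r volume) (h : IsBorderedResolvent a b z R K T Q) (v : LpC n p) :
    -Δ (toDistr n p (T v)) = toDistr n β (ha.toLp a • v : LpC n β) + toDistr n p (z • T v) := by
  obtain ⟨w, hw, hlim⟩ := exists_seq_mulDomain_tendsto hp ha.1 v
  have hA : Continuous fun v : LpC n p => (ha.toLp a • v : LpC n β) := by
    have hL : LipschitzWith ‖ha.toLp a‖₊ fun v : LpC n p => (ha.toLp a • v : LpC n β) := by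
      refine LipschitzWith.of_dist_le_mul fun x y => ?_
      rw [dist_eq_norm, dist_eq_norm, sub_eq_add_neg, ← Lp.smul_neg, ← Lp.add_smul,
        ← sub_eq_add_neg]
      exact Lp.norm_smul_le _ _
    exact hL.continuous
  have h₁ : Continuous fun v : LpC n p => -Δ (toDistr n p (T v)) := by
    simp only [← TemperedDistribution.laplacianCLM_apply]
    fun_prop
  have h₂ : Continuous fun v : LpC n p =>
      toDistr n β (ha.toLp a • v : LpC n β) + toDistr n p (z • T v) := by
    fun_prop
  refine tendsto_nhds_unique ((h₁.tendsto v).comp hlim) (((h₂.tendsto v).comp hlim).congr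
    fun k => ?_)
  have h₃ : toDistr n β (ha.toLp a • w k : LpC n β) = toDistr n p (mulOp p a ⟨w k, hw k⟩) := by
    ext φ
    simp only [Lp.toTemperedDistributionCLM_apply, Lp.toTemperedDistribution_apply]
    refine integral_congr_ae ?_
    filter_upwards [Lp.coeFn_lpSMul (r := β) (ha.toLp a) (w k), ha.coeFn_toLp,
      (mem_mulDomain.mp (hw k)).coeFn_toLp] with x h₁ h₂ h₃
    rw [h₁]
    have : mulOp p a ⟨w k, hw k⟩ = (mem_mulDomain.mp (hw k)).toLp (fun x => a x * w k x) := rfl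
    rw [this, h₃, Pi.smul_apply', h₂, smul_eq_mul (a x)]
  have h₄ := h.extends_RA ⟨w k, hw k⟩
  simp only [Function.comp_apply] at h₄ ⊢
  rw [h₄, h.isResolvent.toDistr_apply, h₃, map_add]

/-- True on the domain of $A$, and preserved in the limit because $B$ is closed. -/
theorem IsBorderedResolvent.mul_RA {z : ℂ} {R K T Q : LpC n p →L[ℂ] LpC n p} (hp : p ≠ ∞)
    (ha : AEStronglyMeasurable a volume) (h : IsBorderedResolvent a b z R K T Q) (v : LpC n p) :
    Q v =ᵐ[volume] fun x => b x * T v x := by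
  obtain ⟨w, hw, hlim⟩ := exists_seq_mulDomain_tendsto hp ha v
  refine ae_eq_mul_of_tendsto ((T.continuous.tendsto v).comp hlim)
    ((Q.continuous.tendsto v).comp hlim) fun k => ?_
  have h₁ := h.extends_RA ⟨w k, hw k⟩
  have h₂ := h.extends_BRA ⟨w k, hw k⟩
  obtain ⟨h₃, h₄⟩ := h.eq_BR (mulOp p a ⟨w k, hw k⟩)
  simp only [Function.comp_apply] at h₁ h₂ ⊢
  rw [h₁, h₂, ← h₄]
  exact (mem_mulDomain.mp h₃).coeFn_toLp

theorem IsBorderedResolvent.mul_R {z : ℂ} {R K T Q : LpC n p →L[ℂ] LpC n p}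
    (h : IsBorderedResolvent a b z R K T Q) (f : LpC n p) :
    K f =ᵐ[volume] fun x => b x * R f x := by
  obtain ⟨h₃, h₄⟩ := h.eq_BR f
  rw [← h₄]
  exact (mem_mulDomain.mp h₃).coeFn_toLp

variable (p β b) in
/-- The pairs `(u, g)` with `b u ∈ L_p` and `-Δ u + a (b u) = g` in the sense of distributions. -/
noncomputable def weakGraph (ha : MemLp a r volume) : Submodule ℂ (LpC n p × LpC n p) where
  carrier := {x | ∃ v : LpC n p, v =ᵐ[volume] (fun y => b y * x.1 y) ∧
    -Δ (toDistr n p x.1) + toDistr n β (ha.toLp a • v : LpC n β) = toDistr n p x.2}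
  zero_mem' := ⟨0, by
    filter_upwards [Lp.coeFn_zero ℂ p (volume : Measure (Space n))] with x hx
    rw [hx, Prod.fst_zero, hx, Pi.zero_apply, mul_zero], by
    rw [Lp.smul_zero, Prod.fst_zero, Prod.snd_zero, map_zero, map_zero, add_zero,
      ← TemperedDistribution.laplacianCLM_apply, map_zero, neg_zero]⟩
  add_mem' := by
    rintro x y ⟨v, hv, hv'⟩ ⟨w, hw, hw'⟩
    refine ⟨v + w, ?_, ?_⟩
    · filter_upwards [hv, hw, Lp.coeFn_add v w, Lp.coeFn_add x.1 y.1] with t h₁ h₂ h₃ h₄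
      rw [Prod.fst_add, h₃, h₄, Pi.add_apply, Pi.add_apply, h₁, h₂, mul_add]
    · rw [Prod.snd_add, Prod.fst_add, Lp.add_smul, map_add, map_add, map_add, ← hv', ← hw',
        ← TemperedDistribution.laplacianCLM_apply, map_add]
      simp only [TemperedDistribution.laplacianCLM_apply]
      abel
  smul_mem' := by
    rintro c x ⟨v, hv, hv'⟩
    refine ⟨c • v, ?_, ?_⟩
    · filter_upwards [hv, Lp.coeFn_smul c v, Lp.coeFn_smul c x.1] with t h₁ h₂ h₃
      rw [Prod.smul_fst, h₂, h₃, Pi.smul_apply, Pi.smul_apply, h₁, smul_eq_mul, smul_eq_mul,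
        mul_left_comm]
    · rw [Prod.smul_snd, Prod.smul_fst, ← Lp.smul_comm, map_smul, map_smul, map_smul, ← hv',
        ← TemperedDistribution.laplacianCLM_apply, map_smul, smul_add, smul_neg,
        TemperedDistribution.laplacianCLM_apply]

theorem mem_weakGraph {ha : MemLp a r volume} {x : LpC n p × LpC n p} :
    x ∈ weakGraph p β b ha ↔ ∃ v : LpC n p, v =ᵐ[volume] (fun y => b y * x.1 y) ∧
      -Δ (toDistr n p x.1) + toDistr n β (ha.toLp a • v : LpC n β) = toDistr n p x.2 := Iff.rfl

/-- For a generator $u=Rf-Tv$ take $v=(1+Q)^{-1}Kf$: then $v=Kf-Qv=b(Rf-Tv)=bu$, and subtracting the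
equations for $Rf$ and $Tv$ gives $-\Delta u+av=f+zu$. The right-hand condition no longer mentions
$z$, so the span over all $z$ is covered. -/
theorem schrodingerGraph_le_weakGraph (hp : p ≠ ∞) (ha : MemLp a r volume) :
    schrodingerGraph p a b ≤ weakGraph p β b ha := by
  rw [schrodingerGraph, Submodule.span_le]
  rintro ⟨u, g⟩ ⟨z, -, R, K, T, Q, h, hQ, f, hu, hg⟩
  simp only at hu hg
  set v := Ring.inverse (1 + Q) (K f) with hv
  have hv' : v + Q v = K f := by
    have : ((1 + Q) * Ring.inverse (1 + Q)) (K f) = K f := by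
      rw [Ring.mul_inverse_cancel _ hQ]; rfl
    exact this
  refine ⟨v, ?_, ?_⟩
  · have h₁ : v = K f - Q v := eq_sub_of_add_eq hv'
    have h₂ := Lp.coeFn_sub (K f) (Q v)
    rw [← h₁] at h₂
    have h₃ := Lp.coeFn_sub (R f) (T v)
    rw [← hu] at h₃
    filter_upwards [h₂, h₃, h.mul_RA hp ha.1 v, h.mul_R f] with x h₁ h₂ h₃ h₄
    rw [h₁, h₂, Pi.sub_apply, Pi.sub_apply, h₃, h₄, mul_sub]
  · have h₁ := h.isResolvent.toDistr_apply f
    have h₂ := h.toDistr_RA (β := β) hp ha v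
    simp only
    rw [hg, hu, map_sub, ← TemperedDistribution.laplacianCLM_apply, map_sub,
      TemperedDistribution.laplacianCLM_apply, TemperedDistribution.laplacianCLM_apply, neg_sub,
      ← neg_sub_neg, h₁, h₂]
    simp only [map_add, map_sub, map_smul, smul_sub]
    abel

theorem snd_eq_zero_of_mem_weakGraph {ha : MemLp a r volume} {x : LpC n p × LpC n p}
    (hx : x ∈ weakGraph p β b ha) (h : x.1 = 0) : x.2 = 0 := by
  obtain ⟨v, hv, hg⟩ := hx
  have hv₀ : v = 0 := by
    refine Lp.ext ?_
    filter_upwards [hv, Lp.coeFn_zero ℂ p (volume : Measure (Space n))] with t h₁ h₂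
    rw [h₁, h, h₂, Pi.zero_apply, mul_zero]
  rw [h, hv₀, Lp.smul_zero, map_zero, map_zero, add_zero,
    ← TemperedDistribution.laplacianCLM_apply, map_zero, neg_zero] at hg
  exact toDistr_injective n p (by rw [← hg, map_zero])

/-- An eigenfunction of the Schrödinger operator solves the eigenvalue equation in the sense of
distributions. -/
theorem IsEigenvalue.exists_weak_solution (hp : p ≠ ∞) (ha : MemLp a r volume) {lam : ℂ}
    (h : IsEigenvalue (schrodingerOp p a b) lam) :
    ∃ u v : LpC n p, u ≠ 0 ∧ v =ᵐ[volume] (fun y => b y * u y) ∧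
      -Δ (toDistr n p u) + toDistr n β (ha.toLp a • v : LpC n β) = lam • toDistr n p u := by
  obtain ⟨u, hu, hlam⟩ := h
  have hle := schrodingerGraph_le_weakGraph (β := β) (b := b) hp ha
  -- `toLinearPMap` has the given submodule as its graph only when that submodule is single-valued;
  -- this is inherited from `weakGraph`.
  have hmem := (schrodingerGraph p a b).mem_graph_toLinearPMap
    (fun x hx hx' => snd_eq_zero_of_mem_weakGraph (hle hx) hx') u
  obtain ⟨v, hv, hv'⟩ := mem_weakGraph.mp (hle hmem)
  refine ⟨u, v, hu, hv, ?_⟩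
  rw [← map_smul, ← hlam]
  exact hv'

end Graph

end Schrodinger

namespace Schrodinger

open FourierTransform Complex.HadamardThreeLines

/-! ### The Fourier integral: Plancherel and the two endpoint estimates. -/

section Fourier

variable {n : ℕ}

theorem continuous_fourier {f : Space n → ℂ} (hf : Integrable f) : Continuous (𝓕 f) :=
  VectorFourier.fourierIntegral_continuous Real.continuous_fourierChar
    (innerSL ℝ).continuous₂ hf

theorem norm_fourier_le (f : Space n → ℂ) (ξ : Space n) : ‖𝓕 f ξ‖ ≤ ∫ x, ‖f x‖ :=
  VectorFourier.norm_fourierIntegral_le_integral_norm _ _ _ _ _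

theorem integral_fourier_mul_eq {f g : Space n → ℂ} (hf : Integrable f) (hg : Integrable g) :
    ∫ ξ, 𝓕 f ξ * g ξ = ∫ x, f x * 𝓕 g x := by
  have h := VectorFourier.integral_fourierIntegral_smul_eq_flip (e := Real.fourierChar)
    (L := innerₗ (Space n)) Real.continuous_fourierChar (innerSL ℝ).continuous₂ hf hg
  rw [flip_innerₗ] at h
  exact h

theorem integrable_fourier_mul {f g : Space n → ℂ} (hf : Integrable f) (hg : Integrable g) :
    Integrable fun ξ => 𝓕 f ξ * g ξ :=
  hg.bdd_mul (continuous_fourier hf).aestronglyMeasurable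
    (Eventually.of_forall (norm_fourier_le f))

theorem fourier_sum_mul {ι : Type*} (s : Finset ι) (c : ι → ℂ) {f : ι → Space n → ℂ}
    (hf : ∀ i ∈ s, Integrable (f i)) (ξ : Space n) :
    𝓕 (fun x => ∑ i ∈ s, c i * f i x) ξ = ∑ i ∈ s, c i * 𝓕 (f i) ξ := by
  have hcomm : ∀ (t : Circle) (c w : ℂ), t • (c * w) = c * t • w := fun t c w => by
    rw [Circle.smul_def, Circle.smul_def, smul_eq_mul, smul_eq_mul, mul_left_comm]
  simp only [Real.fourier_eq, Finset.smul_sum, hcomm]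
  rw [integral_finsetSum]
  · exact Finset.sum_congr rfl fun i _ => integral_const_mul _ _
  · intro i hi
    exact ((Real.fourierIntegral_convergent_iff ξ).mpr (hf i hi)).const_mul (c i)

theorem fourier_toDistr_one {f : Space n → ℂ} (hf : MemLp f 1 volume)
    (hF : MemLp (𝓕 f) ∞ volume) : toDistr n ∞ hF.toLp = 𝓕 (toDistr n 1 hf.toLp) := by
  ext φ
  simp only [TemperedDistribution.fourier_apply, Lp.toTemperedDistributionCLM_apply,
    Lp.toTemperedDistribution_apply, smul_eq_mul]
  have h₁ : ∫ x, φ x * (hF.toLp : LpC n ∞) x = ∫ x, φ x * 𝓕 f x := integral_congr_ae (by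
    filter_upwards [hF.coeFn_toLp] with x hx
    rw [hx])
  have h₂ : ∫ x, (𝓕 φ) x * (hf.toLp : LpC n 1) x = ∫ x, 𝓕 (φ : Space n → ℂ) x * f x := integral_congr_ae (by
    filter_upwards [hf.coeFn_toLp] with x hx
    rw [hx, SchwartzMap.fourier_coe])
  rw [h₁, h₂, integral_fourier_mul_eq φ.integrable (memLp_one_iff_integrable.mp hf)]

theorem memLp_top_fourier {f : Space n → ℂ} (hf : Integrable f) : MemLp (𝓕 f) ∞ volume :=
  memLp_top_of_bound (continuous_fourier hf).aestronglyMeasurable _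
    (Eventually.of_forall (norm_fourier_le f))

/-- **Plancherel's theorem** for integrable square-integrable functions. -/
theorem memLp_two_fourier {f : Space n → ℂ} (hf : Integrable f) (hf₂ : MemLp f 2 volume) :
    MemLp (𝓕 f) 2 volume ∧ eLpNorm (𝓕 f) 2 volume = eLpNorm f 2 volume := by
  have hf₁ : MemLp f 1 volume := memLp_one_iff_integrable.mpr hf
  have hF := memLp_top_fourier hf
  have h₁ := fourier_toDistr_one hf₁ hF
  have h₂ : 𝓕 (toDistr n 2 hf₂.toLp) = toDistr n 2 (𝓕 hf₂.toLp) :=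
    Lp.fourier_toTemperedDistribution_eq _
  have h₃ : toDistr n 1 hf₁.toLp = toDistr n 2 hf₂.toLp := by
    ext φ
    simp only [Lp.toTemperedDistributionCLM_apply, Lp.toTemperedDistribution_apply]
    refine integral_congr_ae ?_
    filter_upwards [hf₁.coeFn_toLp, hf₂.coeFn_toLp] with x h₁ h₂
    rw [h₁, h₂]
  -- The integral and the $L_2$ transform represent the transform of one and the same tempered
  -- distribution, so they agree almost everywhere.
  have h₄ := (hF.coeFn_toLp).symm.trans (ae_eq_of_toDistr_eq _ _ (h₁.trans (h₃ ▸ h₂)))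
  refine ⟨(Lp.memLp _).ae_eq h₄.symm, ?_⟩
  rw [eLpNorm_congr_ae h₄, ← Lp.enorm_def, ← eLpNorm_congr_ae hf₂.coeFn_toLp, ← Lp.enorm_def]
  exact enorm_eq_iff_norm_eq.mpr (Lp.norm_fourier_eq _)

theorem norm_integral_fourier_mul_le_one {f g : Space n → ℂ} (hg : Integrable g) :
    ‖∫ ξ, 𝓕 f ξ * g ξ‖ ≤ (∫ x, ‖f x‖) * ∫ x, ‖g x‖ := by
  rw [← integral_const_mul]
  refine norm_integral_le_of_norm_le (hg.norm.const_mul _) (Eventually.of_forall fun ξ => ?_)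
  rw [norm_mul]
  gcongr
  exact norm_fourier_le f ξ

theorem norm_integral_fourier_mul_le_two {f g : Space n → ℂ} (hf : Integrable f)
    (hf₂ : MemLp f 2 volume) (hg₂ : MemLp g 2 volume) :
    ‖∫ ξ, 𝓕 f ξ * g ξ‖ ≤
      (∫ x, ‖f x‖ ^ (2 : ℝ)) ^ (1 / 2 : ℝ) * (∫ x, ‖g x‖ ^ (2 : ℝ)) ^ (1 / 2 : ℝ) := by
  obtain ⟨hF, hF'⟩ := memLp_two_fourier hf hf₂
  have e2 : ENNReal.ofReal 2 = 2 := by norm_num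
  have h := integral_mul_norm_le_Lp_mul_Lq (μ := (volume : Measure (Space n)))
    (Real.HolderConjugate.two_two) (by rwa [e2] : MemLp (𝓕 f) _ volume)
    (by rwa [e2] : MemLp g _ volume)
  have h₀ : (∫ x, ‖𝓕 f x‖ ^ (2 : ℝ)) ^ (1 / 2 : ℝ) = (∫ x, ‖f x‖ ^ (2 : ℝ)) ^ (1 / 2 : ℝ) := by
    rw [hF.eLpNorm_eq_integral_rpow_norm two_ne_zero ENNReal.ofNat_ne_top,
      hf₂.eLpNorm_eq_integral_rpow_norm two_ne_zero ENNReal.ofNat_ne_top,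
      ENNReal.ofReal_eq_ofReal_iff (by positivity) (by positivity)] at hF'
    simpa using hF'
  rw [h₀] at h
  refine le_trans ?_ h
  refine (norm_integral_le_integral_norm _).trans_eq ?_
  simp only [norm_mul]

end Fourier

/-! ### Hausdorff–Young for simple functions by the three lines theorem. -/

section Interpolation

/-- The analytic family `c ‖c‖ ^ (q (1 - z / 2) - 1)` of powers used in the interpolation between
`L_1` and `L_2`. -/
noncomputable def powFamily (q : ℝ) (z c : ℂ) : ℂ := c * (‖c‖ : ℂ) ^ (q * (1 - z / 2) - 1)

variable {q : ℝ}

theorem powFamily_zero (z : ℂ) : powFamily q z 0 = 0 := zero_mul _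

theorem norm_powFamily (z : ℂ) {c : ℂ} (hc : c ≠ 0) :
    ‖powFamily q z c‖ = ‖c‖ ^ (q * (1 - z.re / 2)) := by
  have h : 0 < ‖c‖ := norm_pos_iff.mpr hc
  have h' : (q * (1 - z / 2) - 1 : ℂ).re = q * (1 - z.re / 2) - 1 := by simp
  rw [powFamily, norm_mul, Complex.norm_cpow_eq_rpow_re_of_pos h, h', Real.rpow_sub_one h.ne',
    mul_div_cancel₀ _ h.ne']

/-- The hypothesis `h` holds with $t=1$ on the line $\Re z=0$ and $t=2$ on $\Re z=1$, so both
boundary norms are expressed by $\int|f|^q$. -/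
theorem norm_powFamily_rpow (z c : ℂ) {t : ℝ} (ht : t ≠ 0) (hq : q ≠ 0)
    (h : q * (1 - z.re / 2) * t = q) : ‖powFamily q z c‖ ^ t = ‖c‖ ^ q := by
  rcases eq_or_ne c 0 with rfl | hc
  · rw [powFamily_zero, norm_zero, Real.zero_rpow ht, Real.zero_rpow hq]
  · rw [norm_powFamily z hc, ← Real.rpow_mul (norm_nonneg c), h]

theorem norm_powFamily_le (hq : 0 < q) {z : ℂ} (hz : z ∈ verticalClosedStrip 0 1) (c : ℂ) :
    ‖powFamily q z c‖ ≤ max 1 ‖c‖ ^ q := by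
  rcases eq_or_ne c 0 with rfl | hc
  · rw [powFamily_zero, norm_zero]
    positivity
  have h₀ : 0 ≤ z.re := hz.1
  have h₁ : z.re ≤ 1 := hz.2
  rw [norm_powFamily z hc]
  calc ‖c‖ ^ (q * (1 - z.re / 2)) ≤ max 1 ‖c‖ ^ (q * (1 - z.re / 2)) := by
        refine Real.rpow_le_rpow (norm_nonneg c) (le_max_right _ _) ?_
        exact mul_nonneg hq.le (by linarith)
    _ ≤ max 1 ‖c‖ ^ q := by
        refine Real.rpow_le_rpow_of_exponent_le (le_max_left _ _) ?_
        nlinarith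

theorem differentiable_powFamily (q : ℝ) (c : ℂ) : Differentiable ℂ fun z => powFamily q z c := by
  rcases eq_or_ne c 0 with rfl | hc
  · simp only [powFamily_zero]
    fun_prop
  · have h : (‖c‖ : ℂ) ≠ 0 := by simpa using hc
    unfold powFamily
    intro z
    exact ((by fun_prop : DifferentiableAt ℂ (fun z : ℂ => (q * (1 - z / 2) - 1 : ℂ)) z).const_cpow
      (Or.inl h)).const_mul c

variable {n : ℕ}

/-- The value $0$ is left out because its fibre may have infinite measure. -/
theorem simpleFunc_map_eq_sum (f : SimpleFunc (Space n) ℂ) {φ : ℂ → ℂ} (hφ : φ 0 = 0)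
    (x : Space n) :
    φ (f x) = ∑ c ∈ f.range.erase 0, φ c * (f ⁻¹' {c}).indicator (fun _ => 1) x := by
  by_cases h : f x = 0
  · rw [h, hφ, eq_comm]
    refine Finset.sum_eq_zero fun c hc => ?_
    rw [Set.indicator_of_notMem, mul_zero]
    rw [Set.mem_preimage, Set.mem_singleton_iff, h]
    exact (Finset.ne_of_mem_erase hc).symm
  · rw [Finset.sum_eq_single (f x)]
    · rw [Set.indicator_of_mem (by simp), mul_one]
    · intro c _ hc
      rw [Set.indicator_of_notMem, mul_zero]
      rw [Set.mem_preimage, Set.mem_singleton_iff]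
      exact hc.symm
    · intro h'
      exact absurd (Finset.mem_erase.mpr ⟨h, f.mem_range_self x⟩) h'

theorem integrable_indicator_preimage {f : SimpleFunc (Space n) ℂ} (hf : Integrable f) {c : ℂ}
    (hc : c ∈ f.range.erase 0) :
    Integrable ((f ⁻¹' {c}).indicator (fun _ => (1 : ℂ))) :=
  (integrable_indicator_iff (f.measurableSet_fiber c)).mpr
    (integrableOn_const (SimpleFunc.integrable_iff.mp hf c (Finset.ne_of_mem_erase hc)).ne)

/-- A finite sum in which $z$ enters only through the coefficients: the pairing is entire in $z$ and
bounded on the strip. -/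
theorem integral_fourier_powFamily (q : ℝ) {f g : SimpleFunc (Space n) ℂ} (hf : Integrable f)
    (hg : Integrable g) (z : ℂ) :
    ∫ ξ, 𝓕 (fun x => powFamily q z (f x)) ξ * powFamily q z (g ξ) =
      ∑ c ∈ f.range.erase 0, ∑ d ∈ g.range.erase 0, powFamily q z c * powFamily q z d *
        ∫ ξ, 𝓕 ((f ⁻¹' {c}).indicator (fun _ => (1 : ℂ))) ξ *
          (g ⁻¹' {d}).indicator (fun _ => 1) ξ := by
  simp only [simpleFunc_map_eq_sum f (powFamily_zero z),
    simpleFunc_map_eq_sum g (powFamily_zero z)]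
  simp only [fourier_sum_mul _ _ fun c hc => integrable_indicator_preimage hf hc]
  simp only [Finset.sum_mul_sum]
  have hi : ∀ c ∈ f.range.erase 0, ∀ d ∈ g.range.erase 0, Integrable fun ξ =>
      powFamily q z c * 𝓕 ((f ⁻¹' {c}).indicator (fun _ => (1 : ℂ))) ξ *
        (powFamily q z d * (g ⁻¹' {d}).indicator (fun _ => 1) ξ) := fun c hc d hd => by
    have := (integrable_fourier_mul (integrable_indicator_preimage hf hc)
      (integrable_indicator_preimage hg hd)).const_mul (powFamily q z c * powFamily q z d)
    exact this.congr (Eventually.of_forall fun ξ => by ring)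
  rw [integral_finsetSum _ fun c hc => integrable_finsetSum _ fun d hd => hi c hc d hd]
  refine Finset.sum_congr rfl fun c hc => ?_
  rw [integral_finsetSum _ fun d hd => hi c hc d hd]
  refine Finset.sum_congr rfl fun d hd => ?_
  rw [← integral_const_mul]
  exact integral_congr_ae (Eventually.of_forall fun ξ => by ring)

/-- The Hausdorff–Young inequality for simple functions, in its bilinear form. -/
theorem norm_integral_fourier_simpleFunc_le (hq : 1 < q) (hq₂ : q < 2)
    {f g : SimpleFunc (Space n) ℂ} (hf : Integrable f) (hg : Integrable g) :
    ‖∫ ξ, 𝓕 (f : Space n → ℂ) ξ * g ξ‖ ≤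
      (∫ x, ‖f x‖ ^ q) ^ (1 / q) * (∫ x, ‖g x‖ ^ q) ^ (1 / q) := by
  have hq₀ : 0 < q := by linarith
  have hmap : ∀ {f : SimpleFunc (Space n) ℂ}, Integrable f → ∀ z,
      MemLp (fun x => powFamily q z (f x)) 1 volume ∧
        MemLp (fun x => powFamily q z (f x)) 2 volume := by
    intro f hf z
    have hs : (f.map (powFamily q z)).FinMeasSupp volume :=
      (SimpleFunc.integrable_iff_finMeasSupp.mp hf).map (powFamily_zero z)
    exact ⟨(SimpleFunc.memLp_iff_finMeasSupp one_ne_zero ENNReal.one_ne_top).mpr hs,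
      (SimpleFunc.memLp_iff_finMeasSupp two_ne_zero ENNReal.ofNat_ne_top).mpr hs⟩
  set A := ∫ x, ‖f x‖ ^ q with hA
  set B := ∫ x, ‖g x‖ ^ q with hB
  have hA₀ : 0 ≤ A := integral_nonneg fun x => by positivity
  have hB₀ : 0 ≤ B := integral_nonneg fun x => by positivity
  set Φ : ℂ → ℂ := fun z => ∫ ξ, 𝓕 (fun x => powFamily q z (f x)) ξ * powFamily q z (g ξ) with hΦ
  have hΦ_eq : Φ = _ := funext (integral_fourier_powFamily q hf hg)
  -- The point where the exponent $q(1-z/2)-1$ vanishes, so that the family returns $f$ and $g$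
  -- themselves.
  set θ : ℝ := 2 - 2 / q with hθ
  have hθ₀ : 0 ≤ θ := by
    rw [hθ, sub_nonneg, div_le_iff₀ hq₀]; linarith
  have hθ₁ : θ ≤ 1 := by
    have : 1 ≤ 2 / q := by rw [le_div_iff₀ hq₀]; linarith
    linarith
  have hmem : (θ : ℂ) ∈ verticalClosedStrip 0 1 := ⟨hθ₀, hθ₁⟩
  have hd : DiffContOnCl ℂ Φ (verticalStrip 0 1) := by
    rw [hΦ_eq]
    refine Differentiable.diffContOnCl fun z => ?_
    refine DifferentiableAt.fun_sum fun c _ => DifferentiableAt.fun_sum fun d _ => ?_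
    exact ((differentiable_powFamily q c z).mul (differentiable_powFamily q d z)).mul_const _
  have hbdd : BddAbove ((norm ∘ Φ) '' verticalClosedStrip 0 1) := by
    refine ⟨∑ c ∈ f.range.erase 0, ∑ d ∈ g.range.erase 0, max 1 ‖c‖ ^ q * max 1 ‖d‖ ^ q *
        ‖∫ ξ, 𝓕 ((f ⁻¹' {c}).indicator (fun _ => (1 : ℂ))) ξ *
          (g ⁻¹' {d}).indicator (fun _ => 1) ξ‖, ?_⟩
    rintro _ ⟨z, hz, rfl⟩
    rw [Function.comp_apply, hΦ_eq]
    refine (norm_sum_le _ _).trans (Finset.sum_le_sum fun c _ => ?_)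
    refine (norm_sum_le _ _).trans (Finset.sum_le_sum fun d _ => ?_)
    rw [norm_mul, norm_mul]
    gcongr
    · exact norm_powFamily_le hq₀ hz c
    · exact norm_powFamily_le hq₀ hz d
  have h0 : ∀ z ∈ Complex.re ⁻¹' {0}, ‖Φ z‖ ≤ A * B := by
    intro z hz
    have hz : z.re = 0 := hz
    have h : ∀ c, ‖powFamily q z c‖ = ‖c‖ ^ q := fun c => by
      rw [← Real.rpow_one ‖powFamily q z c‖]
      exact norm_powFamily_rpow z c one_ne_zero hq₀.ne' (by rw [hz]; ring)
    have := norm_integral_fourier_mul_le_one (f := fun x => powFamily q z (f x))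
      (memLp_one_iff_integrable.mp (hmap hg z).1)
    simpa only [h] using this
  have h1 : ∀ z ∈ Complex.re ⁻¹' {1}, ‖Φ z‖ ≤ A ^ (1 / 2 : ℝ) * B ^ (1 / 2 : ℝ) := by
    intro z hz
    have hz : z.re = 1 := hz
    have h : ∀ c, ‖powFamily q z c‖ ^ (2 : ℝ) = ‖c‖ ^ q := fun c =>
      norm_powFamily_rpow z c two_ne_zero hq₀.ne' (by rw [hz]; ring)
    have := norm_integral_fourier_mul_le_two (memLp_one_iff_integrable.mp (hmap hf z).1)
      (hmap hf z).2 (hmap hg z).2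
    simpa only [h] using this
  have key := norm_le_interp_of_mem_verticalClosedStrip₀₁' Φ hmem hd hbdd h0 h1
  have hpow : ∀ c, powFamily q θ c = c := fun c => by
    have : (q * (1 - (θ : ℂ) / 2) - 1 : ℂ) = 0 := by
      have hqc : (q : ℂ) ≠ 0 := by exact_mod_cast hq₀.ne'
      rw [hθ]
      push_cast
      field_simp
      ring
    rw [powFamily, this, Complex.cpow_zero, mul_one]
  have hΦθ : Φ θ = ∫ ξ, 𝓕 (f : Space n → ℂ) ξ * g ξ := by
    simp only [hΦ, hpow]
  rw [hΦθ, Complex.ofReal_re] at key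
  refine key.trans_eq ?_
  -- The boundary bounds $AB$ and $(AB)^{1/2}$ interpolate to $(AB)^{1/q}$.
  have hexp : (1 - θ) + 1 / 2 * θ = 1 / q := by rw [hθ]; field_simp; ring
  have hne : (1 - θ) + 1 / 2 * θ ≠ 0 := by rw [hexp]; positivity
  rw [← Real.mul_rpow hA₀ hB₀, ← Real.rpow_mul (by positivity),
    ← Real.rpow_add' (by positivity) hne, hexp, Real.mul_rpow hA₀ hB₀]

end Interpolation

end Schrodinger

namespace Schrodinger

open FourierTransform

/-! ### Recovering an $L_{q'}$ norm from pairings with simple functions. -/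

section Duality

variable {n : ℕ} {q q' : ℝ} {F : Space n → ℂ} {C M : ℝ}

/-- Simple approximations of $g$ dominated by $2|g|$; boundedness of $F$ and integrability of $g$
let the pairing pass to the limit. -/
theorem norm_integral_mul_le_of_simpleFunc (hq : 0 < q) (hF : Measurable F) (hC : ∀ x, ‖F x‖ ≤ C)
    (H : ∀ g : SimpleFunc (Space n) ℂ, Integrable g →
      ‖∫ x, F x * g x‖ ≤ M * (∫ x, ‖g x‖ ^ q) ^ (1 / q))
    {g : Space n → ℂ} (hg : Measurable g) (hg₁ : Integrable g)
    (hgq : Integrable fun x => ‖g x‖ ^ q) :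
    ‖∫ x, F x * g x‖ ≤ M * (∫ x, ‖g x‖ ^ q) ^ (1 / q) := by
  set G : ℕ → SimpleFunc (Space n) ℂ :=
    SimpleFunc.approxOn g hg Set.univ 0 (Set.mem_univ _) with hG
  have hlim : ∀ x, Tendsto (fun k => G k x) atTop (𝓝 (g x)) := fun x =>
    SimpleFunc.tendsto_approxOn hg (Set.mem_univ _) (by simp)
  have hle : ∀ k x, ‖G k x‖ ≤ 2 * ‖g x‖ := fun k x => by
    rw [two_mul]
    exact SimpleFunc.norm_approxOn_zero_le hg (Set.mem_univ _) x k
  have hGi : ∀ k, Integrable (G k) := fun k =>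
    (hg₁.norm.const_mul 2).mono' (G k).aestronglyMeasurable (Eventually.of_forall (hle k))
  have h₁ : Tendsto (fun k => ∫ x, F x * G k x) atTop (𝓝 (∫ x, F x * g x)) := by
    refine tendsto_integral_of_dominated_convergence (fun x => C * (2 * ‖g x‖))
      (fun k => hF.aestronglyMeasurable.mul (G k).aestronglyMeasurable)
      ((hg₁.norm.const_mul 2).const_mul C) (fun k => Eventually.of_forall fun x => ?_)
      (Eventually.of_forall fun x => (hlim x).const_mul _)
    rw [norm_mul]
    gcongr
    · exact (norm_nonneg _).trans (hC x)
    · exact hC x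
    · exact hle k x
  have h₂ : Tendsto (fun k => ∫ x, ‖G k x‖ ^ q) atTop (𝓝 (∫ x, ‖g x‖ ^ q)) := by
    refine tendsto_integral_of_dominated_convergence (fun x => 2 ^ q * ‖g x‖ ^ q)
      (fun k => ((G k).aestronglyMeasurable.norm.aemeasurable.pow_const q).aestronglyMeasurable)
      (hgq.const_mul _) (fun k => Eventually.of_forall fun x => ?_)
      (Eventually.of_forall fun x => (hlim x).norm.rpow_const (Or.inr hq.le))
    rw [Real.norm_of_nonneg (by positivity), ← Real.mul_rpow (by positivity) (by positivity)]
    exact Real.rpow_le_rpow (norm_nonneg _) (hle k x) hq.le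
  exact le_of_tendsto_of_tendsto' h₁.norm
    ((h₂.rpow_const (Or.inr (by positivity))).const_mul M) fun k => H (G k) (hGi k)

/-- Test against the Hölder extremal of $F$. Since $F$ is not yet known to lie in $L_{q'}$, the
extremal is first restricted to balls, where boundedness of $F$ makes everything finite; then the
balls exhaust the space. -/
theorem eLpNorm_le_of_simpleFunc (hqq' : q.HolderConjugate q') (hF : Measurable F)
    (hC : ∀ x, ‖F x‖ ≤ C) (hM : 0 ≤ M)
    (H : ∀ g : SimpleFunc (Space n) ℂ, Integrable g →
      ‖∫ x, F x * g x‖ ≤ M * (∫ x, ‖g x‖ ^ q) ^ (1 / q)) :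
    eLpNorm F (ENNReal.ofReal q') volume ≤ ENNReal.ofReal M := by
  have hq : 0 < q := hqq'.pos
  have hq' : 0 < q' := hqq'.symm.pos
  have hq'₁ : 0 < q' - 1 := sub_pos.mpr hqq'.symm.lt
  have hC₀ : 0 ≤ C := (norm_nonneg _).trans (hC 0)
  -- Chosen so that $Fg_0=|F|^{q'}=|g_0|^q$.
  set g₀ : Space n → ℂ := fun x => (starRingEnd ℂ) (F x) * (‖F x‖ ^ (q' - 2) : ℝ) with hg₀
  have hg₀m : Measurable g₀ :=
    (Complex.continuous_conj.measurable.comp hF).mul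
      (Complex.measurable_ofReal.comp (hF.norm.pow_const _))
  have hnorm : ∀ x, ‖g₀ x‖ = ‖F x‖ ^ (q' - 1) := fun x => by
    rcases eq_or_ne (F x) 0 with h | h
    · simp only [hg₀, h, map_zero, zero_mul, norm_zero]
      rw [Real.zero_rpow hq'₁.ne']
    · have : 0 < ‖F x‖ := norm_pos_iff.mpr h
      simp only [hg₀, norm_mul, RCLike.norm_conj, Complex.norm_real]
      rw [Real.norm_of_nonneg (by positivity), ← Real.rpow_one_add' (norm_nonneg _) (by linarith)]
      congr 1
      ring
  have hmul : ∀ x, F x * g₀ x = (‖F x‖ ^ q' : ℝ) := fun x => by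
    rcases eq_or_ne (F x) 0 with h | h
    · simp only [hg₀, h, map_zero, zero_mul, norm_zero]
      rw [Real.zero_rpow hq'.ne', Complex.ofReal_zero]
    · have : 0 < ‖F x‖ := norm_pos_iff.mpr h
      simp only [hg₀]
      rw [← mul_assoc, Complex.mul_conj, Complex.normSq_eq_norm_sq, ← Complex.ofReal_mul,
        ← Real.rpow_natCast, ← Real.rpow_add this]
      congr 2
      norm_num
  have hpow : ∀ x, ‖g₀ x‖ ^ q = ‖F x‖ ^ q' := fun x => by
    rw [hnorm, ← Real.rpow_mul (norm_nonneg _), hqq'.symm.sub_one_mul_conj]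
  have key : ∀ k : ℕ, ∫⁻ x in Metric.ball 0 (k : ℝ), ‖F x‖ₑ ^ q' ≤ ENNReal.ofReal (M ^ q') := by
    intro k
    set S := Metric.ball (0 : Space n) (k : ℝ) with hS
    have hSm : MeasurableSet S := measurableSet_ball
    have hSv : volume S ≠ ∞ := measure_ball_lt_top.ne
    set I := ∫ x in S, ‖F x‖ ^ q' with hI
    have hFi : IntegrableOn (fun x => ‖F x‖ ^ q') S := by
      refine Measure.integrableOn_of_bounded (M := C ^ q') hSv
        (hF.norm.pow_const _).aestronglyMeasurable (Eventually.of_forall fun x => ?_)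
      rw [Real.norm_of_nonneg (by positivity)]
      exact Real.rpow_le_rpow (norm_nonneg _) (hC x) hq'.le
    have hgi : IntegrableOn g₀ S := by
      refine Measure.integrableOn_of_bounded (M := C ^ (q' - 1)) hSv
        hg₀m.aestronglyMeasurable (Eventually.of_forall fun x => ?_)
      rw [hnorm]
      exact Real.rpow_le_rpow (norm_nonneg _) (hC x) hq'₁.le
    have e₁ : ∀ x, ‖S.indicator g₀ x‖ ^ q = S.indicator (fun x => ‖F x‖ ^ q') x := fun x => by
      by_cases hx : x ∈ S
      · rw [Set.indicator_of_mem hx, Set.indicator_of_mem hx, hpow]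
      · rw [Set.indicator_of_notMem hx, Set.indicator_of_notMem hx, norm_zero,
          Real.zero_rpow hq.ne']
    have e₂ : ∀ x, F x * S.indicator g₀ x = S.indicator (fun x => ((‖F x‖ ^ q' : ℝ) : ℂ)) x :=
      fun x => by
      by_cases hx : x ∈ S
      · rw [Set.indicator_of_mem hx, Set.indicator_of_mem hx, hmul]
      · rw [Set.indicator_of_notMem hx, Set.indicator_of_notMem hx, mul_zero]
    have h := norm_integral_mul_le_of_simpleFunc hq hF hC H (hg₀m.indicator hSm)
      ((integrable_indicator_iff hSm).mpr hgi)
      (by simpa only [e₁] using (integrable_indicator_iff hSm).mpr hFi)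
    have hI₀ : 0 ≤ I := integral_nonneg fun x => by positivity
    simp only [e₁, e₂] at h
    rw [integral_indicator hSm, integral_indicator hSm, integral_complex_ofReal, ← hI,
      Complex.norm_real, Real.norm_of_nonneg hI₀] at h
    have hIM : I ≤ M ^ q' := by
      rcases hI₀.eq_or_lt with h0 | h0
      · rw [← h0]; positivity
      -- The pairing bound reads $I\le M I^{1/q}$, and $I$ is finite and positive, so $I^{1/q}$
      -- cancels.
      · have h₁ : I ^ (1 / q') ≤ M := by
          have h₂ : I ^ (1 / q') * I ^ (1 / q) = I := by
            rw [← Real.rpow_add h0, add_comm, one_div, one_div, hqq'.inv_add_inv_eq_one,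
              Real.rpow_one]
          have h₃ : 0 < I ^ (1 / q) := by positivity
          exact le_of_mul_le_mul_right (h₂.trans_le h) h₃
        calc I = (I ^ (1 / q')) ^ q' := by
              rw [← Real.rpow_mul hI₀, one_div, inv_mul_cancel₀ hq'.ne', Real.rpow_one]
          _ ≤ M ^ q' := Real.rpow_le_rpow (by positivity) h₁ hq'.le
    refine le_trans (le_of_eq ?_) (ENNReal.ofReal_le_ofReal hIM)
    rw [hI, ofReal_integral_eq_lintegral_ofReal hFi (Eventually.of_forall fun x => by positivity)]
    refine lintegral_congr fun x => ?_
    rw [← ENNReal.ofReal_rpow_of_nonneg (norm_nonneg _) hq'.le, ofReal_norm]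
  have hU : (⋃ k : ℕ, Metric.ball (0 : Space n) (k : ℝ)) = Set.univ := Metric.iUnion_ball_nat 0
  have hall : ∫⁻ x, ‖F x‖ₑ ^ q' ≤ ENNReal.ofReal (M ^ q') := by
    rw [← setLIntegral_univ, ← hU, setLIntegral_iUnion_of_directed]
    · exact iSup_le key
    · exact Monotone.directed_le fun i j hij =>
        Metric.ball_subset_ball (by exact_mod_cast hij)
  have hq'0 : ENNReal.ofReal q' ≠ 0 := by simpa using hq'
  rw [eLpNorm_eq_lintegral_rpow_enorm_toReal hq'0 ENNReal.ofReal_ne_top,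
    ENNReal.toReal_ofReal hq'.le]
  calc (∫⁻ x, ‖F x‖ₑ ^ q') ^ (1 / q') ≤ (ENNReal.ofReal (M ^ q')) ^ (1 / q') :=
        ENNReal.rpow_le_rpow hall (by positivity)
    _ = ENNReal.ofReal M := by
        rw [ENNReal.ofReal_rpow_of_nonneg (by positivity) (by positivity), ← Real.rpow_mul hM,
          mul_one_div_cancel hq'.ne', Real.rpow_one]

end Duality

/-! ### Hausdorff–Young on all of $L_q$. -/

section HausdorffYoung

variable {n : ℕ} {q q' : ℝ≥0∞}

theorem eLpNorm_fourier_simpleFunc_le (hq : 1 < q) (hq₂ : q < 2)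
    [hqq' : ENNReal.HolderConjugate q q'] {f : SimpleFunc (Space n) ℂ} (hf : Integrable f)
    (hfq : MemLp f q volume) :
    eLpNorm (𝓕 (f : Space n → ℂ)) q' volume ≤ eLpNorm f q volume := by
  have hqt : q ≠ ∞ := (hq₂.trans ENNReal.ofNat_lt_top).ne
  have hq0 : q ≠ 0 := (zero_lt_one.trans hq).ne'
  have hq1 : 1 < q.toReal := by
    rw [← ENNReal.toReal_one]
    exact (ENNReal.toReal_lt_toReal ENNReal.one_ne_top hqt).mpr hq
  have hq2 : q.toReal < 2 := by
    rw [← ENNReal.toReal_ofNat]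
    exact (ENNReal.toReal_lt_toReal hqt ENNReal.ofNat_ne_top).mpr hq₂
  have hq't : q' ≠ ∞ := by
    rintro rfl
    have := ENNReal.HolderConjugate.inv_add_inv_eq_one q ∞
    rw [ENNReal.inv_top, add_zero, ENNReal.inv_eq_one] at this
    exact hq.ne' this
  have hconj : q.toReal.HolderConjugate q'.toReal := ENNReal.HolderConjugate.toReal hq1
  have h := eLpNorm_le_of_simpleFunc hconj (continuous_fourier hf).measurable (norm_fourier_le f)
    (M := (∫ x, ‖f x‖ ^ q.toReal) ^ (1 / q.toReal)) (by positivity)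
    fun g hg => norm_integral_fourier_simpleFunc_le hq1 hq2 hf hg
  rwa [ENNReal.ofReal_toReal hq't, one_div, ← hfq.eLpNorm_eq_integral_rpow_norm hq0 hqt] at h

/-- The **Hausdorff–Young inequality**: for `1 ≤ q ≤ 2` the Fourier transform of a function in
`L_q` is a function in `L_{q'}` of no greater norm. -/
theorem exists_fourier_eq [Fact (1 ≤ q)] [Fact (1 ≤ q')] (hq₂ : q ≤ 2)
    [hqq' : ENNReal.HolderConjugate q q'] (f : LpC n q) :
    ∃ g : LpC n q', toDistr n q' g = 𝓕 (toDistr n q f) ∧ ‖g‖ ≤ ‖f‖ := by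
  have hq₁ : 1 ≤ q := Fact.out
  rcases hq₁.eq_or_lt with rfl | hq₁
  · obtain rfl : q' = ∞ := ENNReal.HolderConjugate.unique 1 q' ∞
    have hf : Integrable f := L1.integrable_coeFn f
    have hF := memLp_top_fourier hf
    refine ⟨hF.toLp, ?_, ?_⟩
    · rw [fourier_toDistr_one (Lp.memLp f) hF, Lp.toLp_coeFn]
    · rw [Lp.norm_toLp]
      refine ENNReal.toReal_le_of_le_ofReal (norm_nonneg f) ?_
      rw [eLpNorm_exponent_top]
      refine eLpNormEssSup_le_of_ae_bound (Eventually.of_forall fun x => ?_)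
      exact (norm_fourier_le f x).trans_eq (L1.norm_eq_integral_norm f).symm
  rcases hq₂.eq_or_lt with rfl | hq₂
  · obtain rfl : q' = 2 := ENNReal.HolderConjugate.unique 2 q' 2
    exact ⟨𝓕 f, (Lp.fourier_toTemperedDistribution_eq f).symm, (Lp.norm_fourier_eq f).le⟩
  have hqt : q ≠ ∞ := (hq₂.trans ENNReal.ofNat_lt_top).ne
  have hq0 : q ≠ 0 := (zero_lt_one.trans hq₁).ne'
  -- The endpoints $q=1,2$ are settled. For $1<q<2$, a simple function in $L_q$ is integrable, so
  -- its transform is an integral; the rest is density.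
  have hsimple : ∀ f : Lp.simpleFunc ℂ q (volume : Measure (Space n)),
      ∃ g : LpC n q', toDistr n q' g = 𝓕 (toDistr n q f) ∧ ‖g‖ ≤ ‖f‖ := by
    intro f
    set s := Lp.simpleFunc.toSimpleFunc f with hs
    have hsq : MemLp s q volume := Lp.simpleFunc.memLp f
    have hsi : Integrable s := (SimpleFunc.memLp_iff_integrable hq0 hqt).mp hsq
    have hs1 : MemLp s 1 volume := memLp_one_iff_integrable.mpr hsi
    have hle := eLpNorm_fourier_simpleFunc_le (q' := q') hq₁ hq₂ hsi hsq
    have hF : MemLp (𝓕 (s : Space n → ℂ)) q' volume :=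
      ⟨(continuous_fourier hsi).aestronglyMeasurable, hle.trans_lt hsq.2⟩
    have hF' := memLp_top_fourier hsi
    have hae := Lp.simpleFunc.toSimpleFunc_eq_toFun f
    refine ⟨hF.toLp, ?_, ?_⟩
    · have h₁ := fourier_toDistr_one hs1 hF'
      have h₂ : toDistr n q' hF.toLp = toDistr n ∞ hF'.toLp := by
        ext φ
        simp only [Lp.toTemperedDistributionCLM_apply, Lp.toTemperedDistribution_apply]
        refine integral_congr_ae ?_
        filter_upwards [hF.coeFn_toLp, hF'.coeFn_toLp] with x h₁ h₂
        rw [h₁, h₂]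
      have h₃ : toDistr n 1 hs1.toLp = toDistr n q f := by
        ext φ
        simp only [Lp.toTemperedDistributionCLM_apply, Lp.toTemperedDistribution_apply]
        refine integral_congr_ae ?_
        filter_upwards [hs1.coeFn_toLp, hae] with x h₁ h₂
        rw [h₁, h₂]
      rw [h₂, h₁, h₃]
    · rw [Lp.norm_toLp]
      have h := ENNReal.toReal_mono hsq.2.ne hle
      rwa [eLpNorm_congr_ae hae, ← Lp.norm_def] at h
  obtain ⟨w, hw⟩ : ∃ w : ℕ → Lp.simpleFunc ℂ q (volume : Measure (Space n)),
      Tendsto (fun k => (w k : LpC n q)) atTop (𝓝 f) := by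
    obtain ⟨w, hw, hlim⟩ := mem_closure_iff_seq_limit.mp (Lp.simpleFunc.denseRange hqt f)
    choose w' hw' using hw
    exact ⟨w', by simpa only [hw'] using hlim⟩
  choose g hg hg' using hsimple
  -- The transforms were picked by choice, but $L_{q'}$ embeds injectively in the distributions.
  -- Hence differences match, and the norm bound becomes a Lipschitz bound.
  have hsub : ∀ k l, ‖g (w k) - g (w l)‖ ≤ ‖(w k : LpC n q) - w l‖ := by
    intro k l
    have : g (w k) - g (w l) = g (w k - w l) := by
      refine toDistr_injective n q' ?_
      rw [map_sub, hg, hg, hg, AddSubgroup.coe_sub, map_sub]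
      exact ((fourierCLM ℂ 𝓢'(Space n, ℂ)).map_sub _ _).symm
    rw [this]
    exact hg' _
  have hcauchy : CauchySeq fun k => g (w k) := by
    refine Metric.cauchySeq_iff.mpr fun ε hε => ?_
    obtain ⟨N, hN⟩ := Metric.cauchySeq_iff.mp hw.cauchySeq ε hε
    refine ⟨N, fun k hk l hl => ?_⟩
    rw [dist_eq_norm]
    exact (hsub k l).trans_lt (by simpa [dist_eq_norm] using hN k hk l hl)
  obtain ⟨g₀, hg₀⟩ := cauchySeq_tendsto_of_complete hcauchy
  refine ⟨g₀, ?_, le_of_tendsto_of_tendsto' hg₀.norm hw.norm fun k => hg' (w k)⟩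
  have hc : Continuous fun f : LpC n q => 𝓕 (toDistr n q f) := by
    fun_prop
  exact tendsto_nhds_unique (((toDistr n q').continuous.tendsto g₀).comp hg₀)
    (((hc.tendsto f).comp hw).congr fun k => (hg (w k)).symm)

/-- The inverse transform is the transform followed by $x\mapsto-x$, which preserves Lebesgue
measure and hence the norm. -/
theorem exists_fourierInv_eq [Fact (1 ≤ q)] [Fact (1 ≤ q')] (hq₂ : q ≤ 2)
    [hqq' : ENNReal.HolderConjugate q q'] (f : LpC n q) :
    ∃ g : LpC n q', toDistr n q' g = 𝓕⁻ (toDistr n q f) ∧ ‖g‖ ≤ ‖f‖ := by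
  obtain ⟨g, hg, hg'⟩ := exists_fourier_eq (q' := q') hq₂ f
  have hneg := Measure.measurePreserving_neg (volume : Measure (Space n))
  refine ⟨Lp.compMeasurePreserving Neg.neg hneg g, ?_, ?_⟩
  · ext φ
    have hψ : ∀ x, (𝓕⁻ (𝓕⁻ φ) : 𝓢(Space n, ℂ)) x = φ (-x) := fun x => by
      rw [SchwartzMap.fourierInv_coe, Real.fourierInv_eq_fourier_neg, ← SchwartzMap.fourier_coe,
        FourierTransform.fourier_fourierInv_eq]
    have h := DFunLike.congr_fun hg (𝓕⁻ (𝓕⁻ φ))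
    rw [TemperedDistribution.fourier_apply, FourierTransform.fourier_fourierInv_eq] at h
    rw [TemperedDistribution.fourierInv_apply, ← h]
    simp only [Lp.toTemperedDistributionCLM_apply, Lp.toTemperedDistribution_apply, hψ]
    rw [← integral_neg_eq_self]
    refine integral_congr_ae ?_
    have h₁ := hneg.quasiMeasurePreserving.ae_eq_comp (Lp.coeFn_compMeasurePreserving g hneg)
    filter_upwards [h₁] with x hx
    simp only [Function.comp_apply, neg_neg] at hx
    rw [hx]
  · rwa [Lp.norm_compMeasurePreserving]

end HausdorffYoung

end Schrodinger

namespace Schrodinger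

open FourierTransform

/-! ### Temperate growth of the resolvent symbol. -/

section Symbol

variable {n : ℕ} {lam : ℂ}

/-- The half-line is closed, so $\lambda$ has positive distance $d$ from it. Taking $\delta=d/2$
leaves room for slightly negative $y$, hence an open set on which to differentiate. -/
theorem exists_pos_le_norm_ofReal_sub (hlam : ∀ t : ℝ, 0 ≤ t → lam ≠ t) :
    ∃ δ : ℝ, 0 < δ ∧ ∀ y : ℝ, -δ < y → δ ≤ ‖(y : ℂ) - lam‖ := by
  have hcl : IsClosed (Complex.ofReal '' Set.Ici 0) :=
    Complex.isometry_ofReal.isClosedEmbedding.isClosedMap _ isClosed_Ici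
  have hne : (Complex.ofReal '' Set.Ici 0).Nonempty := ⟨_, 0, Set.self_mem_Ici, rfl⟩
  have hmem : lam ∉ Complex.ofReal '' Set.Ici 0 := by
    rintro ⟨t, ht, h⟩
    exact hlam t ht h.symm
  have hpos := (hcl.notMem_iff_infDist_pos hne).mp hmem
  set d := Metric.infDist lam (Complex.ofReal '' Set.Ici 0) with hd
  have hle : ∀ y : ℝ, 0 ≤ y → d ≤ ‖(y : ℂ) - lam‖ := fun y hy => by
    rw [← dist_eq_norm, dist_comm]
    exact Metric.infDist_le_dist_of_mem ⟨y, hy, rfl⟩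
  refine ⟨d / 2, half_pos hpos, fun y hy => ?_⟩
  rcases le_or_gt 0 y with h | h
  · linarith [hle y h]
  · have h₀ := hle 0 le_rfl
    have h₁ : ‖((0 : ℝ) : ℂ) - lam‖ ≤ ‖(y : ℂ) - lam‖ + ‖(y : ℂ)‖ := by
      refine le_trans (le_of_eq ?_) (norm_sub_le _ _)
      congr 1
      push_cast
      ring
    rw [Complex.norm_real, Real.norm_of_nonpos h.le] at h₁
    linarith

theorem iteratedDeriv_inv_ofReal_sub {t : Set ℝ} (ht : IsOpen t)
    (h : ∀ y ∈ t, (y : ℂ) - lam ≠ 0) (k : ℕ) :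
    Set.EqOn (iteratedDeriv k fun y : ℝ => ((y : ℂ) - lam)⁻¹)
      (fun y => (-1) ^ k * (k.factorial : ℂ) * (((y : ℂ) - lam)⁻¹) ^ (k + 1)) t := by
  induction k with
  | zero =>
    intro y _
    simp
  | succ k ih =>
    intro y hy
    rw [iteratedDeriv_succ, (ih.eventuallyEq_of_mem (ht.mem_nhds hy)).deriv_eq]
    have h₁ : HasDerivAt (fun y : ℝ => (y : ℂ) - lam) 1 y :=
      (HasDerivAt.ofReal_comp (hasDerivAt_id y)).sub_const lam
    have h₂ := ((h₁.inv (h y hy)).pow (k + 1)).const_mul ((-1) ^ k * (k.factorial : ℂ))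
    refine (HasDerivAt.deriv h₂).trans ?_
    simp only [Nat.factorial_succ, Pi.inv_apply]
    have := h y hy
    rw [div_eq_mul_inv, ← inv_pow]
    push_cast
    ring

/-- The $k$-th derivative of $(y-\lambda)^{-1}$ is bounded by $k!\,\delta^{-k-1}$ for $y>-\delta$;
compose with the polynomial $c\|x\|^2$. -/
theorem hasTemperateGrowth_symbol_inv (n : ℕ) (hlam : ∀ t : ℝ, 0 ≤ t → lam ≠ t) (c : ℝ)
    (hc : 0 ≤ c) :
    (fun x : Space n => (((c * ‖x‖ ^ 2 : ℝ) : ℂ) - lam)⁻¹).HasTemperateGrowth := by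
  obtain ⟨δ, hδ, h⟩ := exists_pos_le_norm_ofReal_sub hlam
  set t := Set.Ioi (-δ) with ht
  have hto : IsOpen t := isOpen_Ioi
  have hne : ∀ y ∈ t, (y : ℂ) - lam ≠ 0 := fun y hy => norm_pos_iff.mp (hδ.trans_le (h y hy))
  have hrange : Set.range (fun x : Space n => c * ‖x‖ ^ 2) ⊆ t := by
    rintro _ ⟨x, rfl⟩
    exact (neg_neg_of_pos hδ).trans_le (by positivity)
  have hdiff : ContDiffOn ℝ ((⊤ : ℕ∞) : WithTop ℕ∞) (fun y : ℝ => ((y : ℂ) - lam)⁻¹) t :=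
    ((Complex.ofRealCLM.contDiff.sub contDiff_const).contDiffOn).inv hne
  refine Function.HasTemperateGrowth.comp' (g := fun y : ℝ => ((y : ℂ) - lam)⁻¹)
    (f := fun x : Space n => c * ‖x‖ ^ 2) hrange hto.uniqueDiffOn hdiff (fun N => ?_)
    (by fun_prop)
  refine ⟨0, ∑ k ∈ Finset.range (N + 1), k.factorial * (δ⁻¹) ^ (k + 1), by positivity,
    fun k hk y hy => ?_⟩
  rw [norm_iteratedFDerivWithin_eq_norm_iteratedDerivWithin, iteratedDerivWithin_of_isOpen hto hy,
    iteratedDeriv_inv_ofReal_sub hto hne k hy, pow_zero, mul_one]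
  refine le_trans ?_ (Finset.single_le_sum (f := fun k => (k.factorial : ℝ) * (δ⁻¹) ^ (k + 1))
    (fun _ _ => by positivity) (Finset.mem_range.mpr (Nat.lt_succ_of_le hk)))
  rw [norm_mul, norm_mul, norm_pow, norm_neg, norm_one, one_pow, one_mul, norm_pow, norm_inv,
    Complex.norm_natCast]
  gcongr
  exact h y hy

end Symbol

/-! ### The Birman–Schwinger bound. -/

section BirmanSchwinger

variable {n : ℕ} {p r s β β' γ γ' κ : ℝ≥0∞} {a b : Space n → ℂ} {lam : ℂ}
  [Fact (1 ≤ p)] [Fact (1 ≤ β)] [Fact (1 ≤ β')] [Fact (1 ≤ γ)] [Fact (1 ≤ γ')]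

/-- The inverse `((2π)² |ξ|² - λ)⁻¹` of the symbol of `-Δ - λ`. -/
noncomputable def resolventSymbol (n : ℕ) (lam : ℂ) (ξ : Space n) : ℂ :=
  ((((2 * Real.pi) ^ 2 * ‖ξ‖ ^ 2 : ℝ) : ℂ) - lam)⁻¹

theorem hasTemperateGrowth_resolventSymbol (n : ℕ) (hlam : ∀ t : ℝ, 0 ≤ t → lam ≠ t) :
    (resolventSymbol n lam).HasTemperateGrowth :=
  hasTemperateGrowth_symbol_inv n hlam _ (by positivity)

/-- A tempered distribution `u` with `(-Δ - λ) u = w` is obtained from `w` by the Fourier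
multiplier `((2π)² |ξ|² - λ)⁻¹`. -/
theorem fourier_eq_of_neg_laplacian_sub (hlam : ∀ t : ℝ, 0 ≤ t → lam ≠ t)
    {u w : 𝓢'(Space n, ℂ)} (h : -Δ u - lam • u = w) :
    𝓕 u = TemperedDistribution.smulLeftCLM ℂ (resolventSymbol n lam) (𝓕 w) := by
  have hm := hasTemperateGrowth_resolventSymbol n hlam
  set P : Space n → ℂ := fun ξ => (((2 * Real.pi) ^ 2 * ‖ξ‖ ^ 2 : ℝ) : ℂ) - lam with hP
  have hsq : (fun x : Space n => Complex.ofReal (‖x‖ ^ 2)).HasTemperateGrowth := by fun_prop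
  have hPt : P.HasTemperateGrowth := by fun_prop
  -- With this normalisation of the Fourier transform, $-\Delta$ is multiplication by
  -- $(2\pi)^2|\xi|^2$.
  have h₁ : 𝓕 w = TemperedDistribution.smulLeftCLM ℂ P (𝓕 u) := by
    have hP' : P = (((2 * Real.pi) ^ 2 : ℝ) : ℂ) • (fun x : Space n => Complex.ofReal (‖x‖ ^ 2)) -
        fun _ => lam := by
      ext ξ
      simp [hP]
    rw [hP', TemperedDistribution.smulLeftCLM_sub (by fun_prop) (by fun_prop),
      TemperedDistribution.smulLeftCLM_smul hsq, ← h,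
      TemperedDistribution.laplacian_eq_fourierMultiplierCLM,
      TemperedDistribution.fourierMultiplierCLM_apply]
    have hsub := (fourierCLM ℂ 𝓢'(Space n, ℂ)).map_sub
    simp only [fourierCLM_apply] at hsub
    rw [hsub, FourierTransform.fourier_smul, neg_smul, neg_neg, ← Complex.coe_smul,
      FourierTransform.fourier_smul, FourierTransform.fourier_fourierInv_eq]
    simp
  rw [h₁, TemperedDistribution.smulLeftCLM_smulLeftCLM_apply hPt hm]
  have hone : P * resolventSymbol n lam = fun _ => 1 := by
    obtain ⟨δ, hδ, hle⟩ := exists_pos_le_norm_ofReal_sub hlam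
    ext ξ
    exact mul_inv_cancel₀ (norm_pos_iff.mp (hδ.trans_le (hle _
      ((neg_neg_of_pos hδ).trans_le (by positivity)))))
  rw [hone, TemperedDistribution.smulLeftCLM_const, one_smul]

/-- The **Birman–Schwinger bound**: a nonzero eigenfunction forces the norm bound of the bordered
resolvent to be at least one. -/
theorem IsEigenvalue.one_le_eLpNorm_mul [ENNReal.HolderTriple r p β]
    [ENNReal.HolderConjugate β β'] [ENNReal.HolderTriple κ β' γ] [ENNReal.HolderConjugate γ γ']
    [ENNReal.HolderTriple s γ' p] (hβ : β ≤ 2) (hγ : γ ≤ 2) (hp : p ≠ ∞)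
    (ha : MemLp a r volume) (hb : MemLp b s volume) (hlam : ∀ t : ℝ, 0 ≤ t → lam ≠ t)
    (hm : MemLp (resolventSymbol n lam) κ volume)
    (h : IsEigenvalue (schrodingerOp p a b) lam) :
    1 ≤ (eLpNorm (resolventSymbol n lam) κ volume).toReal * (eLpNorm a r volume).toReal *
      (eLpNorm b s volume).toReal := by
  obtain ⟨u, v, hu, hv, huv⟩ := h.exists_weak_solution (β := β) hp ha
  set w : LpC n β := ha.toLp a • v with hw
  obtain ⟨g, hg, hg'⟩ := exists_fourier_eq (q' := β') hβ (-w)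
  have h₁ : -Δ (toDistr n p u) - lam • toDistr n p u = toDistr n β (-w) := by
    rw [map_neg, ← huv]
    abel
  have h₂ := fourier_eq_of_neg_laplacian_sub hlam h₁
  have hmt := hasTemperateGrowth_resolventSymbol n hlam
  have h₃ : toDistr n γ (hm.toLp _ • g : LpC n γ) =
      TemperedDistribution.smulLeftCLM ℂ (resolventSymbol n lam) (toDistr n β' g) :=
    Lp.toTemperedDistribution_smul_eq hmt hm g
  obtain ⟨u', hu', hle⟩ := exists_fourierInv_eq (q' := γ') hγ (hm.toLp _ • g : LpC n γ)
  have h₄ : toDistr n γ' u' = toDistr n p u := by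
    rw [hu', h₃, hg, ← h₂, FourierTransform.fourierInv_fourier_eq]
  -- The function obtained in $L_{\gamma'}$ and the eigenfunction in $L_p$ are thus the same
  -- function.
  have hae := ae_eq_of_toDistr_eq _ _ h₄
  have hm₀ : 0 ≤ ‖hm.toLp (resolventSymbol n lam)‖ := ENNReal.toReal_nonneg
  have hb₀ : 0 ≤ ‖hb.toLp b‖ := ENNReal.toReal_nonneg
  have hu'v : ‖u'‖ ≤ ‖hm.toLp (resolventSymbol n lam)‖ * (‖ha.toLp a‖ * ‖v‖) := by
    refine hle.trans ((Lp.norm_smul_le _ _).trans ?_)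
    gcongr
    refine hg'.trans ?_
    rw [norm_neg]
    exact Lp.norm_smul_le _ _
  have hvu' : v = (hb.toLp b • u' : LpC n p) := by
    refine Lp.ext ?_
    filter_upwards [hv, hae, Lp.coeFn_lpSMul (r := p) (hb.toLp b) u', hb.coeFn_toLp]
      with x h₁ h₂ h₃ h₄
    rw [h₁, h₃, Pi.smul_apply', h₄, h₂, smul_eq_mul]
  -- If $v=0$, the bound `hu'v` kills $u'$, and with it $u$.
  have hv0 : 0 < ‖v‖ := by
    rw [norm_pos_iff]
    rintro rfl
    rw [norm_zero, mul_zero, mul_zero, norm_le_zero_iff] at hu'v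
    refine hu (toDistr_injective n p ?_)
    rw [← h₄, hu'v, map_zero, map_zero]
  have hfin : ‖v‖ ≤ ‖hb.toLp b‖ * ‖u'‖ := by
    conv_lhs => rw [hvu']
    exact Lp.norm_smul_le _ _
  rw [← Lp.norm_toLp _ hm, ← Lp.norm_toLp _ ha, ← Lp.norm_toLp _ hb]
  have : 1 * ‖v‖ ≤ ‖hm.toLp (resolventSymbol n lam)‖ * ‖ha.toLp a‖ * ‖hb.toLp b‖ * ‖v‖ := by
    rw [one_mul]
    calc ‖v‖ ≤ ‖hb.toLp b‖ * ‖u'‖ := hfin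
      _ ≤ ‖hb.toLp b‖ * (‖hm.toLp (resolventSymbol n lam)‖ * (‖ha.toLp a‖ * ‖v‖)) := by gcongr
      _ = _ := by ring
  exact le_of_mul_le_mul_right this hv0

end BirmanSchwinger

end Schrodinger

namespace Schrodinger

/-! ### Euler's transformation of ${}_2F_1$ by formal power series. -/

section EulerTransformation

/-- The rising factorial `(a)_k = a (a + 1) ⋯ (a + k - 1)`. -/
noncomputable def poch (a : ℝ) (k : ℕ) : ℝ := (ascPochhammer ℝ k).eval a

theorem poch_succ (a : ℝ) (k : ℕ) : poch a (k + 1) = poch a k * (a + k) :=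
  ascPochhammer_succ_eval k a

@[simp]
theorem poch_zero (a : ℝ) : poch a 0 = 1 := by simp [poch]

theorem poch_pos {a : ℝ} (ha : 0 < a) (k : ℕ) : 0 < poch a k := ascPochhammer_pos k a ha

theorem gamma_add_nat {a : ℝ} (ha : 0 < a) (k : ℕ) :
    Real.Gamma (a + k) = Real.Gamma a * poch a k := by
  induction k with
  | zero => simp
  | succ k ih =>
    rw [poch_succ, ← mul_assoc, ← ih, Nat.cast_succ, ← add_assoc,
      Real.Gamma_add_one (by positivity), mul_comm]

/-- Duplication formula; it later cancels the factor $4^k(\nu)_k$ and produces the lower parameter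
$\nu+\tfrac12$. -/
theorem poch_two_mul (a : ℝ) (k : ℕ) :
    poch (2 * a) (2 * k) = 4 ^ k * (poch a k * poch (a + 1 / 2) k) := by
  induction k with
  | zero => simp
  | succ k ih =>
    rw [Nat.mul_succ, poch_succ, poch_succ, ih, poch_succ, poch_succ]
    push_cast
    ring

theorem hasSum_one_sub_rpow (a : ℝ) {w : ℝ} (hw : |w| < 1) :
    HasSum (fun k : ℕ => poch a k / k.factorial * w ^ k) ((1 - w) ^ (-a)) := by
  have h := (Real.one_div_one_sub_rpow_hasFPowerSeriesOnBall_zero a).hasSum (y := w)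
    (by rw [Metric.mem_eball, edist_zero_right]; simpa [← ofReal_norm] using hw)
  rw [zero_add, one_div, ← Real.rpow_neg (by linarith [(abs_lt.mp hw).2])] at h
  refine h.congr_fun fun k => ?_
  rw [FormalMultilinearSeries.ofScalars_apply_eq, smul_eq_mul, ← Ring.multichoose_eq, poch,
    ← Polynomial.ascPochhammer_smeval_eq_eval, ← Ring.factorial_nsmul_multichoose_eq_ascPochhammer,
    nsmul_eq_mul, mul_div_cancel_left₀ _ (by positivity)]

/-- The coefficients of the hypergeometric series. -/
noncomputable def hypCoeff (a b c : ℝ) (k : ℕ) : ℝ := ordinaryHypergeometricCoefficient a b c k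

theorem hypCoeff_zero (a b c : ℝ) : hypCoeff a b c 0 = 1 := by
  simp [hypCoeff, ordinaryHypergeometricCoefficient]

theorem hypCoeff_succ (a b : ℝ) {c : ℝ} (hc : 0 < c) (k : ℕ) :
    (k + 1) * (c + k) * hypCoeff a b c (k + 1) = (a + k) * (b + k) * hypCoeff a b c k := by
  have h₁ : (c + k) ≠ 0 := by positivity
  have h₂ : poch c k ≠ 0 := (poch_pos hc k).ne'
  have h : ∀ j, hypCoeff a b c j = (j.factorial : ℝ)⁻¹ * poch a j * poch b j * (poch c j)⁻¹ :=
    fun j => rfl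
  rw [h, h, poch_succ, poch_succ, poch_succ, Nat.factorial_succ]
  push_cast
  have h₄ : (k.factorial : ℝ) ≠ 0 := by positivity
  have h₅ : (k + 1 : ℝ) ≠ 0 := by positivity
  field_simp

open PowerSeries in
-- Read coefficientwise, the hypergeometric differential equation is the two-term recurrence
-- `hypCoeff_succ`. This lets products of series be handled through their equations.
theorem coeff_hypergeometric_ode (c A B : ℝ) (F : PowerSeries ℝ) (k : ℕ) :
    coeff k (X * (1 - X) * derivative ℝ (derivative ℝ F) +
        (C c - C (A + B + 1) * X) * derivative ℝ F - C (A * B) * F) =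
      (k + 1) * (c + k) * coeff (k + 1) F - (A + k) * (B + k) * coeff k F := by
  have hX : ∀ G : PowerSeries ℝ, coeff k (X * derivative ℝ G) = k * coeff k G := by
    intro G
    cases k with
    | zero => simp
    | succ k =>
      rw [coeff_succ_X_mul, coeff_derivative]
      push_cast
      ring
  have h₁ : X * (1 - X) * derivative ℝ (derivative ℝ F) =
      derivative ℝ (X * derivative ℝ F) - derivative ℝ F -
        (X * derivative ℝ (X * derivative ℝ F) - X * derivative ℝ F) := by
    simp only [Derivation.leibniz, derivative_X, smul_eq_mul]
    ring
  have h₂ : (C c - C (A + B + 1) * X) * derivative ℝ F - C (A * B) * F =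
      C c * derivative ℝ F - C (A + B + 1) * (X * derivative ℝ F) - C (A * B) * F := by ring
  obtain ⟨S, hS⟩ : ∃ S, S = A + B + 1 := ⟨_, rfl⟩
  rw [← hS] at h₂ ⊢
  rw [add_sub_assoc, h₁, h₂]
  simp only [map_add, map_sub, coeff_C_mul, hX, coeff_derivative]
  have h₃ : coeff (k + 1) (X * derivative ℝ F) = (k + 1) * coeff (k + 1) F := by
    rw [coeff_succ_X_mul, coeff_derivative]
    ring
  rw [h₃, hS]
  ring

open PowerSeries in
/-- The coefficients in **Euler's transformation**
`(1 - z) ^ (A + B - c) ₂F₁(A, B; c; z) = ₂F₁(c - A, c - B; c; z)`. -/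
theorem sum_antidiagonal_hypCoeff (A B : ℝ) {c : ℝ} (hc : 0 < c) (k : ℕ) :
    ∑ ij ∈ Finset.HasAntidiagonal.antidiagonal k, poch (c - A - B) ij.1 / ij.1.factorial * hypCoeff A B c ij.2 =
      hypCoeff (c - A) (c - B) c k := by
  set s := c - A - B with hs
  -- The formal series of $(1-X)^{-s}$, characterised by $(1-X)U'=sU$.
  set U : PowerSeries ℝ := PowerSeries.mk fun k => poch s k / k.factorial with hU
  set G : PowerSeries ℝ := PowerSeries.mk fun k => hypCoeff A B c k with hG
  have hU' : (1 - X) * derivative ℝ U = C s * U := by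
    ext k
    rw [sub_mul, one_mul, map_sub, coeff_C_mul, coeff_derivative]
    have h : coeff k (X * derivative ℝ U) = k * coeff k U := by
      cases k with
      | zero => simp
      | succ k =>
        rw [coeff_succ_X_mul, coeff_derivative]
        push_cast
        ring
    rw [h, hU, coeff_mk, coeff_mk, poch_succ, Nat.factorial_succ]
    have h₄ : (k.factorial : ℝ) ≠ 0 := by positivity
    push_cast
    field_simp
    ring
  have hG' : X * (1 - X) * derivative ℝ (derivative ℝ G) +
      (C c - C (A + B + 1) * X) * derivative ℝ G - C (A * B) * G = 0 := by
    ext k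
    rw [coeff_hypergeometric_ode, hG, coeff_mk, coeff_mk, hypCoeff_succ A B hc, sub_self, map_zero]
  have hU'' : (1 - X) * derivative ℝ (derivative ℝ U) = C (s + 1) * derivative ℝ U := by
    have h := congrArg (derivative ℝ) hU'
    simp only [Derivation.leibniz, map_sub, derivative_X, smul_eq_mul, derivative_C,
      Derivation.map_one_eq_zero] at h
    rw [map_add, map_one]
    linear_combination h
  have hH : X * (1 - X) * derivative ℝ (derivative ℝ (U * G)) +
      (C c - C ((c - A) + (c - B) + 1) * X) * derivative ℝ (U * G) -
        C ((c - A) * (c - B)) * (U * G) = 0 := by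
    -- After multiplication by the non-zero-divisor $1-X$, the equations for $U'$ and $U''$ can be
    -- substituted, and what remains is a multiple of the equation for $G$.
    have hne : (1 - X : PowerSeries ℝ) ≠ 0 := by
      intro h
      have := congrArg (coeff 0) h
      simp at this
    refine (mul_eq_zero.mp ?_).resolve_left hne
    simp only [Derivation.leibniz, map_add, smul_eq_mul, map_sub, map_mul, map_one] at hG' hU'' ⊢
    have hCs : (C s : PowerSeries ℝ) = C c - C A - C B := by rw [hs]; simp
    rw [hCs] at hU' hU''
    linear_combination X * (1 - X) * G * hU'' + (X * (C c - C A - C B + 1) * G +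
      2 * X * (1 - X) * derivative ℝ G + (C c - (C c - C A + (C c - C B) + 1) * X) * G) * hU' +
      (1 - X) * U * hG'
  have hrec := fun k => congrArg (coeff k) hH
  simp only [coeff_hypergeometric_ode, map_zero] at hrec
  -- The recurrence determines every coefficient from the constant one, since $(k+1)(c+k)\ne0$.
  have key : ∀ k, coeff k (U * G) = hypCoeff (c - A) (c - B) c k := by
    intro k
    induction k with
    | zero => simp [hU, hG, hypCoeff_zero]
    | succ k ih =>
      have h₁ := hrec k
      have h₂ := hypCoeff_succ (c - A) (c - B) hc k
      rw [ih] at h₁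
      have h₃ : ((k : ℝ) + 1) * (c + k) ≠ 0 := by positivity
      refine mul_left_cancel₀ h₃ ?_
      linarith
  rw [← key k, coeff_mul]
  simp only [hU, hG, coeff_mk]

theorem summable_hypCoeff {A B c z : ℝ} (hA : 0 < A) (hB : 0 < B) (hc : 0 < c) (hz : |z| < 1) :
    Summable fun k => ‖hypCoeff A B c k * z ^ k‖ := by
  have hr := ordinaryHypergeometricSeries_radius_eq_one (𝔸 := ℝ) A B c fun k => by
    have : (0 : ℝ) ≤ k := by positivity
    exact ⟨by linarith, by linarith, by linarith⟩
  have h := (ordinaryHypergeometricSeries ℝ A B c).summable_norm_apply (x := z)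
    (by rw [hr]; simpa [← ofReal_norm] using hz)
  simp only [ordinaryHypergeometricSeries_apply_eq, smul_eq_mul] at h
  exact h

theorem ordinaryHypergeometric_eq_tsum_hypCoeff (a b c z : ℝ) :
    ordinaryHypergeometric a b c z = ∑' k, hypCoeff a b c k * z ^ k := by
  rw [ordinaryHypergeometric_eq_tsum]
  rfl

/-- **Euler's transformation** of the hypergeometric function. -/
theorem one_sub_rpow_mul_ordinaryHypergeometric {A B c z : ℝ} (hA : 0 < A) (hB : 0 < B)
    (hc : 0 < c) (hz : |z| < 1) :
    (1 - z) ^ (A + B - c) * ordinaryHypergeometric A B c z =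
      ordinaryHypergeometric (c - A) (c - B) c z := by
  have h₁ := hasSum_one_sub_rpow (c - A - B) hz
  have h₁n : Summable fun k : ℕ => ‖poch (c - A - B) k / k.factorial * z ^ k‖ := h₁.summable.norm
  have h₂ := summable_hypCoeff hA hB hc hz
  have hexp : A + B - c = -(c - A - B) := by ring
  rw [hexp, ← h₁.tsum_eq, ordinaryHypergeometric_eq_tsum_hypCoeff,
    ordinaryHypergeometric_eq_tsum_hypCoeff,
    tsum_mul_tsum_eq_tsum_sum_antidiagonal_of_summable_norm h₁n h₂]
  refine tsum_congr fun k => ?_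
  rw [← sum_antidiagonal_hypCoeff A B hc k, Finset.sum_mul]
  refine Finset.sum_congr rfl fun ij hij => ?_
  rw [← Finset.HasAntidiagonal.mem_antidiagonal.mp hij, pow_add]
  ring

end EulerTransformation

/-! ### Gamma and Beta integrals. -/

section Beta

theorem lintegral_rpow_mul_exp_neg_mul {a r : ℝ} (ha : 0 < a) (hr : 0 < r) :
    ∫⁻ t in Set.Ioi (0 : ℝ), ENNReal.ofReal (t ^ (a - 1) * Real.exp (-(r * t))) =
      ENNReal.ofReal ((1 / r) ^ a * Real.Gamma a) := by
  have h := Real.integral_rpow_mul_exp_neg_mul_Ioi ha hr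
  rw [← h, ofReal_integral_eq_lintegral_ofReal]
  · refine Integrable.of_integral_ne_zero ?_
    rw [h]
    have := Real.Gamma_pos_of_pos ha
    positivity
  · refine (ae_restrict_iff' measurableSet_Ioi).mpr (Eventually.of_forall fun t ht => ?_)
    have : 0 < t := ht
    positivity

/-- The Beta integral over the half-line. -/
theorem lintegral_beta_Ioi {u v : ℝ} (hu : 0 < u) (hv : 0 < v) :
    ∫⁻ t in Set.Ioi (0 : ℝ), ENNReal.ofReal (t ^ (u - 1) * (1 + t) ^ (-(u + v))) =
      ENNReal.ofReal (Real.Gamma u * Real.Gamma v / Real.Gamma (u + v)) := by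
  have huv : 0 < u + v := add_pos hu hv
  have hΓ := Real.Gamma_pos_of_pos huv
  have hΓu := Real.Gamma_pos_of_pos hu
  have hΓv := Real.Gamma_pos_of_pos hv
  -- Write $\Gamma(u+v)(1+t)^{-(u+v)}=\int_0^\infty s^{u+v-1}e^{-(1+t)s}ds$; Tonelli then gives
  -- $\Gamma(u)\Gamma(v)$.
  have h₁ : ENNReal.ofReal (Real.Gamma (u + v)) *
      ∫⁻ t in Set.Ioi (0 : ℝ), ENNReal.ofReal (t ^ (u - 1) * (1 + t) ^ (-(u + v))) =
      ∫⁻ t in Set.Ioi (0 : ℝ), ∫⁻ s in Set.Ioi (0 : ℝ),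
        ENNReal.ofReal (t ^ (u - 1) * (s ^ (u + v - 1) * Real.exp (-((1 + t) * s)))) := by
    rw [← lintegral_const_mul' _ _ ENNReal.ofReal_ne_top]
    refine setLIntegral_congr_fun measurableSet_Ioi fun t ht => ?_
    have ht : 0 < t := ht
    have h1t : 0 < 1 + t := by positivity
    simp only [ENNReal.ofReal_mul (Real.rpow_nonneg ht.le (u - 1))]
    rw [lintegral_const_mul' _ _ ENNReal.ofReal_ne_top,
      lintegral_rpow_mul_exp_neg_mul huv h1t, mul_left_comm, ← ENNReal.ofReal_mul hΓ.le,
      one_div, Real.inv_rpow h1t.le, Real.rpow_neg h1t.le, mul_comm (Real.Gamma (u + v))]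
  have h₂ : (∫⁻ t in Set.Ioi (0 : ℝ), ∫⁻ s in Set.Ioi (0 : ℝ),
        ENNReal.ofReal (t ^ (u - 1) * (s ^ (u + v - 1) * Real.exp (-((1 + t) * s))))) =
      ENNReal.ofReal (Real.Gamma u * Real.Gamma v) := by
    rw [lintegral_lintegral_swap (Measurable.aemeasurable (by fun_prop))]
    have h₃ : ∀ s ∈ Set.Ioi (0 : ℝ), (∫⁻ t in Set.Ioi (0 : ℝ),
        ENNReal.ofReal (t ^ (u - 1) * (s ^ (u + v - 1) * Real.exp (-((1 + t) * s))))) =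
        ENNReal.ofReal (Real.Gamma u) *
          ENNReal.ofReal (s ^ (v - 1) * Real.exp (-(1 * s))) := by
      intro s hs
      have hs : 0 < s := hs
      have h₄ : ∀ t : ℝ, ENNReal.ofReal
          (t ^ (u - 1) * (s ^ (u + v - 1) * Real.exp (-((1 + t) * s)))) =
          ENNReal.ofReal (s ^ (u + v - 1) * Real.exp (-s)) *
            ENNReal.ofReal (t ^ (u - 1) * Real.exp (-(s * t))) := fun t => by
        rw [← ENNReal.ofReal_mul (by positivity)]
        congr 1
        rw [show -((1 + t) * s) = -s + -(s * t) by ring, Real.exp_add]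
        ring
      simp only [h₄]
      rw [lintegral_const_mul' _ _ ENNReal.ofReal_ne_top, lintegral_rpow_mul_exp_neg_mul hu hs,
        ← ENNReal.ofReal_mul (by positivity), ← ENNReal.ofReal_mul hΓu.le, one_mul, one_div,
        Real.inv_rpow hs.le, show u + v - 1 = u + (v - 1) by ring, Real.rpow_add hs]
      congr 1
      have : s ^ u ≠ 0 := (Real.rpow_pos_of_pos hs u).ne'
      field_simp
    rw [setLIntegral_congr_fun measurableSet_Ioi h₃,
      lintegral_const_mul' _ _ ENNReal.ofReal_ne_top,
      lintegral_rpow_mul_exp_neg_mul hv one_pos, ← ENNReal.ofReal_mul hΓu.le]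
    simp
  have hne : ENNReal.ofReal (Real.Gamma (u + v)) ≠ 0 := by simpa using hΓ
  rw [ENNReal.ofReal_div_of_pos hΓ, ENNReal.eq_div_iff hne ENNReal.ofReal_ne_top, h₁, h₂]

end Beta

/-! ### The radial integral as a hypergeometric function, and the constant $I$. -/

section ResolventIntegral

theorem hypCoeff_nonneg {a b c : ℝ} (ha : 0 < a) (hb : 0 < b) (hc : 0 < c) (k : ℕ) :
    0 ≤ hypCoeff a b c k := by
  have h : hypCoeff a b c k =
    (k.factorial : ℝ)⁻¹ * poch a k * poch b k * (poch c k)⁻¹ := rfl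
  have h₁ := poch_pos ha k
  have h₂ := poch_pos hb k
  have h₃ := poch_pos hc k
  rw [h]
  positivity

theorem ordinaryHypergeometric_pos {a b c z : ℝ} (ha : 0 < a) (hb : 0 < b) (hc : 0 < c)
    (hz₀ : 0 ≤ z) (hz : z < 1) : 0 < ordinaryHypergeometric a b c z := by
  rw [ordinaryHypergeometric_eq_tsum_hypCoeff]
  refine (summable_hypCoeff ha hb hc (abs_lt.mpr ⟨by linarith, hz⟩)).of_norm.tsum_pos
    (fun k => mul_nonneg (hypCoeff_nonneg ha hb hc k) (by positivity)) 0 ?_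
  simp [hypCoeff_zero]

/-- Factor out $(1+t)^2$, expand $(1-w)^{-\nu}$ with $w=4tz/(1+t)^2<1$, and integrate termwise by
the Beta integral. All terms are nonnegative, so the interchange is free. -/
theorem lintegral_rpow_mul_quadratic_rpow {m ν z : ℝ} (hm : 0 < m) (hmν : m < 2 * ν)
    (hz₀ : 0 ≤ z) (hz : z < 1) :
    ∫⁻ t in Set.Ioi (0 : ℝ), ENNReal.ofReal (t ^ (m - 1) * ((1 + t) ^ 2 - 4 * t * z) ^ (-ν)) =
      ENNReal.ofReal (Real.Gamma m * Real.Gamma (2 * ν - m) / Real.Gamma (2 * ν) *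
        ordinaryHypergeometric m (2 * ν - m) (ν + 1 / 2) z) := by
  have hν : 0 < ν := by linarith
  have hB : 0 < 2 * ν - m := by linarith
  have hc : 0 < ν + 1 / 2 := by linarith
  have hexp : ∀ t ∈ Set.Ioi (0 : ℝ),
      ENNReal.ofReal (t ^ (m - 1) * ((1 + t) ^ 2 - 4 * t * z) ^ (-ν)) =
      ∑' k : ℕ, ENNReal.ofReal (poch ν k / k.factorial * (4 * z) ^ k) *
        ENNReal.ofReal (t ^ (m + k - 1) * (1 + t) ^ (-((m + k) + (2 * ν - m + k)))) := by
    intro t ht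
    have ht : 0 < t := ht
    have h1t : 0 < 1 + t := by positivity
    set w := 4 * t * z / (1 + t) ^ 2 with hw
    have hw₀ : 0 ≤ w := by positivity
    have hw₁ : w < 1 := by
      rw [hw, div_lt_one (by positivity)]
      nlinarith [sq_nonneg (1 - t)]
    have hs := hasSum_one_sub_rpow ν (abs_lt.mpr ⟨by linarith, hw₁⟩)
    have hs' := hs.mul_left (t ^ (m - 1) * (1 + t) ^ (-(2 * ν)))
    have h₁ : (1 + t) ^ 2 - 4 * t * z = (1 + t) ^ 2 * (1 - w) := by
      rw [hw]; field_simp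
    rw [h₁, Real.mul_rpow (by positivity) (by linarith), ← Real.rpow_natCast (1 + t) 2,
      ← Real.rpow_mul h1t.le, ← mul_assoc,
      show ((2 : ℕ) : ℝ) * -ν = -(2 * ν) by push_cast; ring, ← hs'.tsum_eq,
      ENNReal.ofReal_tsum_of_nonneg _ hs'.summable]
    · refine tsum_congr fun k => ?_
      have hpk := poch_pos hν k
      rw [← ENNReal.ofReal_mul (by positivity)]
      congr 1
      rw [show m + k - 1 = (m - 1) + k by ring,
        show -(m + k + (2 * ν - m + k)) = -(2 * ν) + -((2 * k : ℕ) : ℝ) by push_cast; ring,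
        Real.rpow_add ht, Real.rpow_add h1t, Real.rpow_neg h1t.le (((2 * k : ℕ) : ℝ)),
        Real.rpow_natCast, Real.rpow_natCast, hw, div_pow, pow_mul]
      field_simp
      ring
    · intro k
      have hpk := poch_pos hν k
      positivity
  rw [setLIntegral_congr_fun measurableSet_Ioi hexp, lintegral_tsum
    fun k => Measurable.aemeasurable (by fun_prop)]
  have hterm : ∀ k : ℕ, (∫⁻ t in Set.Ioi (0 : ℝ),
      ENNReal.ofReal (poch ν k / k.factorial * (4 * z) ^ k) *
        ENNReal.ofReal (t ^ (m + k - 1) * (1 + t) ^ (-((m + k) + (2 * ν - m + k))))) =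
      ENNReal.ofReal (Real.Gamma m * Real.Gamma (2 * ν - m) / Real.Gamma (2 * ν) *
        (hypCoeff m (2 * ν - m) (ν + 1 / 2) k * z ^ k)) := by
    intro k
    have hpk := poch_pos hν k
    have hck := poch_pos hc k
    have hΓ := Real.Gamma_pos_of_pos (show 0 < 2 * ν by positivity)
    rw [lintegral_const_mul' _ _ ENNReal.ofReal_ne_top,
      lintegral_beta_Ioi (by positivity) (by positivity), ← ENNReal.ofReal_mul (by positivity),
      gamma_add_nat hm, gamma_add_nat hB,
      show m + k + (2 * ν - m + k) = 2 * ν + ((2 * k : ℕ) : ℝ) by push_cast; ring,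
      gamma_add_nat (by positivity), poch_two_mul]
    congr 1
    have h : hypCoeff m (2 * ν - m) (ν + 1 / 2) k = (k.factorial : ℝ)⁻¹ * poch m k *
      poch (2 * ν - m) k * (poch (ν + 1 / 2) k)⁻¹ := rfl
    rw [h, mul_pow]
    field_simp
  simp only [hterm]
  have hΓ := Real.Gamma_pos_of_pos (show 0 < 2 * ν by positivity)
  have hΓm := Real.Gamma_pos_of_pos hm
  have hΓB := Real.Gamma_pos_of_pos hB
  have hsum := (summable_hypCoeff hm hB hc (abs_lt.mpr ⟨by linarith, hz⟩)).of_norm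
  rw [ordinaryHypergeometric_eq_tsum_hypCoeff, ← tsum_mul_left,
    ENNReal.ofReal_tsum_of_nonneg _ (hsum.mul_left _)]
  intro k
  have := hypCoeff_nonneg hm hB hc k
  positivity

theorem integral_rpow_mul_quadratic_rpow {m ν θ : ℝ} (hm : 0 < m) (hmν : m < 2 * ν)
    (hθ : Real.cos θ < 1) :
    ∫ t in Set.Ioi (0 : ℝ), t ^ (m - 1) * (t ^ 2 - 2 * t * Real.cos θ + 1) ^ (-ν) =
      Real.Gamma m * Real.Gamma (2 * ν - m) / Real.Gamma (2 * ν) *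
        ordinaryHypergeometric m (2 * ν - m) (ν + 1 / 2) ((1 + Real.cos θ) / 2) := by
  have hcos := Real.neg_one_le_cos θ
  have hz₀ : 0 ≤ (1 + Real.cos θ) / 2 := by linarith
  have hz : (1 + Real.cos θ) / 2 < 1 := by linarith
  have h := lintegral_rpow_mul_quadratic_rpow hm hmν hz₀ hz
  have hq : ∀ t : ℝ, (1 + t) ^ 2 - 4 * t * ((1 + Real.cos θ) / 2) =
      t ^ 2 - 2 * t * Real.cos θ + 1 := fun t => by ring
  simp only [hq] at h
  rw [integral_eq_lintegral_of_nonneg_ae, h, ENNReal.toReal_ofReal]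
  · have := ordinaryHypergeometric_pos hm (show 0 < 2 * ν - m by linarith)
      (show 0 < ν + 1 / 2 by linarith) hz₀ hz
    have := Real.Gamma_pos_of_pos hm
    have := Real.Gamma_pos_of_pos (show 0 < 2 * ν - m by linarith)
    have := Real.Gamma_pos_of_pos (show 0 < 2 * ν by linarith)
    positivity
  · refine (ae_restrict_iff' measurableSet_Ioi).mpr (Eventually.of_forall fun t ht => ?_)
    have ht : 0 < t := ht
    have : 0 ≤ t ^ 2 - 2 * t * Real.cos θ + 1 := by
      nlinarith [sq_nonneg (t - Real.cos θ), Real.cos_sq_le_one θ]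
    simp only [Pi.zero_apply]
    positivity
  · exact Measurable.aestronglyMeasurable (by fun_prop)

/-- Euler's transformation turns the ${}_2F_1$ inside the Legendre function into the one displayed,
and the elementary prefactors multiply to $1$. At $\theta=\pi$ the argument is $0$ and the series
equals $1$. -/
theorem constI_rpow {n : ℕ} (hn : 0 < n) {α θ : ℝ} (hα : (n : ℝ) / 2 < α) (hθ₀ : 0 < θ)
    (hθ₁ : θ < 2 * Real.pi) :
    constI n α θ ^ α = Real.Gamma (α - n / 2) / Real.Gamma α *
      ordinaryHypergeometric (n / 2 : ℝ) (α - n / 2) (α / 2 + 1 / 2) ((1 + Real.cos θ) / 2) := by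
  have hn' : (0 : ℝ) < n := by exact_mod_cast hn
  have hα₀ : 0 < α := by linarith [half_pos hn']
  have hΓα := Real.Gamma_pos_of_pos hα₀
  have hΓB := Real.Gamma_pos_of_pos (show 0 < α - n / 2 by linarith)
  have hc : 0 < α / 2 + 1 / 2 := by positivity
  have hΓc := Real.Gamma_pos_of_pos hc
  rw [constI]
  split_ifs with h
  · rw [h, Real.cos_pi, ← Real.rpow_mul (by positivity), one_div_mul_cancel hα₀.ne',
      Real.rpow_one]
    simp
  · have hsin : Real.sin θ ≠ 0 := by
      intro h0
      obtain ⟨k, hk⟩ := Real.sin_eq_zero_iff.mp h0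
      have hpi := Real.pi_pos
      have h₁ : (0 : ℝ) < k := by
        by_contra hneg
        push Not at hneg
        nlinarith
      have h₂ : (k : ℝ) < 2 := by
        by_contra hneg
        push Not at hneg
        nlinarith
      have h₃ : k = 1 := by
        have h₁ : 0 < k := by exact_mod_cast h₁
        have h₂ : k < 2 := by exact_mod_cast h₂
        omega
      rw [h₃, Int.cast_one, one_mul] at hk
      exact h hk.symm
    have hsq := Real.sin_sq_add_cos_sq θ
    have hs₀ : 0 < Real.sin θ ^ 2 := by positivity
    set x := Real.cos θ with hx
    have hP : 0 < 1 - x := by nlinarith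
    have hM : 0 < 1 + x := by nlinarith
    have hz₀ : 0 ≤ (1 + x) / 2 := by positivity
    have hz : (1 + x) / 2 < 1 := by linarith
    have hA : 0 < (n : ℝ) / 2 := by positivity
    have hB : 0 < α - n / 2 := by linarith
    have hE := one_sub_rpow_mul_ordinaryHypergeometric hA hB hc
      (abs_lt.mpr ⟨by linarith, hz⟩)
    have hF := ordinaryHypergeometric_pos hA hB hc hz₀ hz
    have hL : legendreP (n / 2 - α / 2 - 1 / 2) (1 / 2 - α / 2) (-x) =
        ((1 - x) / (1 + x)) ^ ((1 / 2 - α / 2) / 2) / Real.Gamma (α / 2 + 1 / 2) *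
          ((1 - (1 + x) / 2) ^ ((n : ℝ) / 2 + (α - n / 2) - (α / 2 + 1 / 2)) *
            ordinaryHypergeometric (n / 2 : ℝ) (α - n / 2) (α / 2 + 1 / 2) ((1 + x) / 2)) := by
      rw [legendreP, hE, sub_neg_eq_add, ← sub_eq_add_neg,
        show -((n : ℝ) / 2 - α / 2 - 1 / 2) = α / 2 + 1 / 2 - n / 2 by ring,
        show (n : ℝ) / 2 - α / 2 - 1 / 2 + 1 = α / 2 + 1 / 2 - (α - n / 2) by ring,
        show 1 - (1 / 2 - α / 2) = α / 2 + 1 / 2 by ring]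
    have hu : 0 < 1 - (1 + x) / 2 := by linarith
    rw [hL, Real.mul_rpow (by positivity) (by positivity), ← Real.rpow_mul (by positivity),
      ← Real.rpow_mul (by positivity), one_div_mul_cancel hα₀.ne', Real.rpow_one]
    -- The common exponent of the prefactors from $|\sin\theta|$, from the Legendre function and
    -- from Euler's transformation.
    set e := (α - 1) / 2 with he
    have e₁ : (1 / 2 - 1 / (2 * α)) * α = e := by rw [he]; field_simp
    have e₂ : (n : ℝ) / 2 + (α - n / 2) - (α / 2 + 1 / 2) = e := by rw [he]; ring
    have e₃ : ((1 - x) / (1 + x)) ^ ((1 / 2 - α / 2) / 2) = (√((1 + x) / (1 - x))) ^ e := by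
      rw [Real.sqrt_eq_rpow, ← Real.rpow_mul (by positivity), ← inv_div (1 + x),
        Real.inv_rpow (by positivity), ← Real.rpow_neg (by positivity)]
      congr 1
      rw [he]; ring
    have habs : |Real.sin θ| = √(1 - x) * √(1 + x) := by
      rw [← Real.sqrt_sq_eq_abs, ← Real.sqrt_mul hP.le]
      congr 1
      linarith
    have hone : (2 / |Real.sin θ|) ^ e * (√((1 + x) / (1 - x))) ^ e *
        (1 - (1 + x) / 2) ^ e = 1 := by
      rw [← Real.mul_rpow (by positivity) (by positivity),
        ← Real.mul_rpow (by positivity) (by positivity)]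
      have : 2 / |Real.sin θ| * √((1 + x) / (1 - x)) * (1 - (1 + x) / 2) = 1 := by
        have h₁ : 0 < √(1 - x) := Real.sqrt_pos.mpr hP
        have h₂ : 0 < √(1 + x) := Real.sqrt_pos.mpr hM
        have h₃ : √(1 - x) ^ 2 = 1 - x := Real.sq_sqrt hP.le
        rw [habs, Real.sqrt_div hM.le, show 1 - (1 + x) / 2 = √(1 - x) ^ 2 / 2 by rw [h₃]; ring]
        field_simp
      rw [this, Real.one_rpow]
    rw [e₁, e₂, e₃]
    set F := ordinaryHypergeometric (n / 2 : ℝ) (α - n / 2) (α / 2 + 1 / 2) ((1 + x) / 2) with hFdef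
    calc _ = ((2 / |Real.sin θ|) ^ e * (√((1 + x) / (1 - x))) ^ e * (1 - (1 + x) / 2) ^ e) *
          (Real.Gamma (α - n / 2) / Real.Gamma α * F) := by
            field_simp
      _ = _ := by rw [hone, one_mul]

/-- The law of cosines, after scaling out $|\lambda|$. -/
theorem norm_ofReal_mul_sub_eq {lam : ℂ} {θ : ℝ} (hθ : lam = ‖lam‖ * Complex.exp (θ * Complex.I))
    (t : ℝ) : ‖((‖lam‖ * t : ℝ) : ℂ) - lam‖ =
      ‖lam‖ * (t ^ 2 - 2 * t * Real.cos θ + 1) ^ (1 / 2 : ℝ) := by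
  have h₁ : ((‖lam‖ * t : ℝ) : ℂ) - lam = ‖lam‖ * (t - Complex.exp (θ * Complex.I)) := by
    conv_lhs => rw [hθ]
    have : ‖(‖lam‖ : ℂ) * Complex.exp (θ * Complex.I)‖ = ‖lam‖ := by rw [← hθ]
    rw [this]
    push_cast
    ring
  rw [h₁, norm_mul, Complex.norm_real, norm_norm, ← Real.sqrt_eq_rpow]
  congr 1
  rw [Complex.norm_eq_sqrt_sq_add_sq]
  congr 1
  rw [Complex.sub_re, Complex.sub_im, Complex.ofReal_re, Complex.ofReal_im,
    Complex.exp_ofReal_mul_I_re, Complex.exp_ofReal_mul_I_im]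
  linear_combination Real.sin_sq_add_cos_sq θ

end ResolventIntegral

/-! ### The $L_\alpha$ norm of the symbol. -/

section ResolventNorm

/-- Radial integration on `ℝⁿ` in the variable `t = c ‖ξ‖²`. -/
theorem integral_comp_mul_norm_sq {n : ℕ} (hn : 0 < n) (g : ℝ → ℝ) {c : ℝ} (hc : 0 < c) :
    ∫ ξ : Space n, g (c * ‖ξ‖ ^ 2) =
      (Real.pi / c) ^ ((n : ℝ) / 2) / Real.Gamma (n / 2) *
        ∫ t in Set.Ioi (0 : ℝ), t ^ ((n : ℝ) / 2 - 1) * g t := by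
  have hn' : (0 : ℝ) < n := by exact_mod_cast hn
  have : Nonempty (Fin n) := ⟨⟨0, hn⟩⟩
  have hΓ := Real.Gamma_pos_of_pos (half_pos hn')
  have hball : (volume : Measure (Space n)).real (Metric.ball 0 1) =
      Real.pi ^ ((n : ℝ) / 2) / (n / 2 * Real.Gamma (n / 2)) := by
    rw [Measure.real, EuclideanSpace.volume_ball, Fintype.card_fin, ENNReal.ofReal_one, one_pow,
      one_mul, Real.Gamma_add_one (half_pos hn').ne', ENNReal.toReal_ofReal (by positivity),
      Real.sqrt_eq_rpow, ← Real.rpow_natCast, ← Real.rpow_mul Real.pi_pos.le]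
    congr 2
    ring
  have hscale : ∫ t in Set.Ioi (0 : ℝ), t ^ ((n : ℝ) / 2 - 1) * g (c * t) =
      c⁻¹ ^ ((n : ℝ) / 2) * ∫ t in Set.Ioi (0 : ℝ), t ^ ((n : ℝ) / 2 - 1) * g t := by
    have h := integral_comp_mul_left_Ioi (fun t => t ^ ((n : ℝ) / 2 - 1) * g t) 0 hc
    rw [mul_zero, smul_eq_mul] at h
    have h₁ : ∫ t in Set.Ioi (0 : ℝ), (c * t) ^ ((n : ℝ) / 2 - 1) * g (c * t) =
        c ^ ((n : ℝ) / 2 - 1) * ∫ t in Set.Ioi (0 : ℝ), t ^ ((n : ℝ) / 2 - 1) * g (c * t) := by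
      rw [← integral_const_mul]
      refine setIntegral_congr_fun measurableSet_Ioi fun t ht => ?_
      have ht : 0 < t := ht
      simp only [Real.mul_rpow hc.le ht.le, mul_assoc]
    rw [h₁, Real.rpow_sub_one hc.ne'] at h
    rw [Real.inv_rpow hc.le]
    have hcn : 0 < c ^ ((n : ℝ) / 2) := by positivity
    field_simp at h ⊢
    linarith
  have hsq : ∫ y in Set.Ioi (0 : ℝ), y ^ (n - 1) • g (c * y ^ 2) =
      1 / 2 * ∫ t in Set.Ioi (0 : ℝ), t ^ ((n : ℝ) / 2 - 1) * g (c * t) := by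
    rw [← integral_comp_rpow_Ioi_of_pos (g := fun t => t ^ ((n : ℝ) / 2 - 1) * g (c * t))
      (two_pos), ← integral_const_mul]
    refine setIntegral_congr_fun measurableSet_Ioi fun y hy => ?_
    have hy : 0 < y := hy
    simp only [smul_eq_mul]
    rw [← Real.rpow_mul hy.le, show (2 : ℝ) - 1 = 1 by norm_num, Real.rpow_one, Real.rpow_two,
      show (2 : ℝ) * (n / 2 - 1) = ((n - 1 : ℕ) : ℝ) - 1 by
        rw [Nat.cast_sub hn]; push_cast; ring,
      Real.rpow_sub_one hy.ne', Real.rpow_natCast]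
    field_simp
  rw [integral_fun_norm_addHaar volume fun y => g (c * y ^ 2), finrank_euclideanSpace,
    Fintype.card_fin, hball, hsq, hscale, Real.div_rpow Real.pi_pos.le hc.le, Real.inv_rpow hc.le]
  simp only [nsmul_eq_mul, smul_eq_mul]
  field_simp

/-- Substitute $t=(2\pi)^2|\xi|^2/|\lambda|$ and use the radial integral with $m=n/2$,
$\nu=\alpha/2$; its convergence needs $\alpha>n/2$. -/
theorem integral_norm_resolventSymbol_rpow {n : ℕ} (hn : 0 < n) {α θ : ℝ} (hα : (n : ℝ) / 2 < α)
    {lam : ℂ} (hlam : lam ≠ 0) (hθ₀ : 0 < θ) (hθ₁ : θ < 2 * Real.pi)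
    (hθ : lam = ‖lam‖ * Complex.exp (θ * Complex.I)) :
    ∫ ξ, ‖resolventSymbol n lam ξ‖ ^ α =
      (4 * Real.pi) ^ (-(n : ℝ) / 2) * ‖lam‖ ^ ((n : ℝ) / 2 - α) * constI n α θ ^ α := by
  have hn' : (0 : ℝ) < n := by exact_mod_cast hn
  have hl : 0 < ‖lam‖ := norm_pos_iff.mpr hlam
  have hcos : Real.cos θ < 1 := by
    refine lt_of_le_of_ne (Real.cos_le_one θ) fun h => ?_
    have hpi := Real.pi_pos
    exact hθ₀.ne' ((Real.cos_eq_one_iff_of_lt_of_lt (by linarith) hθ₁).mp h)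
  have hc : 0 < (2 * Real.pi) ^ 2 / ‖lam‖ := by positivity
  have hfun : ∀ ξ : Space n, ‖resolventSymbol n lam ξ‖ ^ α = ‖lam‖ ^ (-α) *
      (fun t : ℝ => (t ^ 2 - 2 * t * Real.cos θ + 1) ^ (-(α / 2)))
        ((2 * Real.pi) ^ 2 / ‖lam‖ * ‖ξ‖ ^ 2) := by
    intro ξ
    have hq : ∀ t : ℝ, 0 ≤ t ^ 2 - 2 * t * Real.cos θ + 1 := fun t => by
      nlinarith [sq_nonneg (t - Real.cos θ), Real.cos_sq_le_one θ]
    have h := norm_ofReal_mul_sub_eq hθ ((2 * Real.pi) ^ 2 / ‖lam‖ * ‖ξ‖ ^ 2)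
    rw [← mul_assoc, mul_div_cancel₀ _ hl.ne'] at h
    have hq' := hq ((2 * Real.pi) ^ 2 / ‖lam‖ * ‖ξ‖ ^ 2)
    rw [resolventSymbol, norm_inv, h, Real.inv_rpow (by positivity),
      Real.mul_rpow hl.le (by positivity), ← Real.rpow_mul hq', mul_inv,
      ← Real.rpow_neg hl.le, ← Real.rpow_neg hq']
    congr 2
    ring
  simp only [hfun]
  rw [integral_const_mul, integral_comp_mul_norm_sq hn
      (fun t : ℝ => (t ^ 2 - 2 * t * Real.cos θ + 1) ^ (-(α / 2))) hc,
    integral_rpow_mul_quadratic_rpow (half_pos hn') (by linarith) hcos, constI_rpow hn hα hθ₀ hθ₁,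
    mul_div_cancel₀ α two_ne_zero]
  have hΓ := Real.Gamma_pos_of_pos (half_pos hn')
  have hdiv : Real.pi / ((2 * Real.pi) ^ 2 / ‖lam‖) = (4 * Real.pi)⁻¹ * ‖lam‖ := by
    have := Real.pi_pos
    field_simp
    norm_num
  rw [hdiv, Real.mul_rpow (by positivity) hl.le, Real.inv_rpow (by positivity),
    ← Real.rpow_neg (by positivity), sub_eq_add_neg ((n : ℝ) / 2) α, Real.rpow_add hl,
    neg_div]
  field_simp

theorem constI_rpow_pos {n : ℕ} (hn : 0 < n) {α θ : ℝ} (hα : (n : ℝ) / 2 < α) (hθ₀ : 0 < θ)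
    (hθ₁ : θ < 2 * Real.pi) : 0 < constI n α θ ^ α := by
  have hn' : (0 : ℝ) < n := by exact_mod_cast hn
  have hα₀ : 0 < α := by linarith [half_pos hn']
  have hcos : Real.cos θ < 1 := by
    refine lt_of_le_of_ne (Real.cos_le_one θ) fun h => ?_
    have hpi := Real.pi_pos
    exact hθ₀.ne' ((Real.cos_eq_one_iff_of_lt_of_lt (by linarith) hθ₁).mp h)
  have hcos' := Real.neg_one_le_cos θ
  rw [constI_rpow hn hα hθ₀ hθ₁]
  exact mul_pos (div_pos (Real.Gamma_pos_of_pos (by linarith)) (Real.Gamma_pos_of_pos hα₀))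
    (ordinaryHypergeometric_pos (half_pos hn') (by linarith) (by positivity) (by linarith)
      (by linarith))

theorem memLp_resolventSymbol {n : ℕ} (hn : 0 < n) {α θ : ℝ} (hα : (n : ℝ) / 2 < α)
    {lam : ℂ} (hlam : ∀ t : ℝ, 0 ≤ t → lam ≠ t) (hθ₀ : 0 < θ) (hθ₁ : θ < 2 * Real.pi)
    (hθ : lam = ‖lam‖ * Complex.exp (θ * Complex.I)) :
    MemLp (resolventSymbol n lam) (ENNReal.ofReal α) volume := by
  have hn' : (0 : ℝ) < n := by exact_mod_cast hn
  have hα₀ : 0 < α := by linarith [half_pos hn']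
  have hlam₀ : lam ≠ 0 := by simpa using hlam 0 le_rfl
  have hl : 0 < ‖lam‖ := norm_pos_iff.mpr hlam₀
  have hI := constI_rpow_pos hn hα hθ₀ hθ₁
  have hmeas : AEStronglyMeasurable (resolventSymbol n lam) volume :=
    (hasTemperateGrowth_resolventSymbol n hlam).1.continuous.aestronglyMeasurable
  rw [← integrable_norm_rpow_iff hmeas (by simpa using hα₀) ENNReal.ofReal_ne_top,
    ENNReal.toReal_ofReal hα₀.le]
  -- A non-integrable function has Bochner integral $0$ by convention, so the positive value just
  -- computed proves integrability.
  refine Integrable.of_integral_ne_zero ?_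
  rw [integral_norm_resolventSymbol_rpow hn hα hlam₀ hθ₀ hθ₁ hθ]
  positivity

theorem eLpNorm_resolventSymbol_rpow {n : ℕ} (hn : 0 < n) {α θ : ℝ} (hα : (n : ℝ) / 2 < α)
    {lam : ℂ} (hlam : ∀ t : ℝ, 0 ≤ t → lam ≠ t) (hθ₀ : 0 < θ) (hθ₁ : θ < 2 * Real.pi)
    (hθ : lam = ‖lam‖ * Complex.exp (θ * Complex.I)) :
    (eLpNorm (resolventSymbol n lam) (ENNReal.ofReal α) volume).toReal ^ α =
      (4 * Real.pi) ^ (-(n : ℝ) / 2) * ‖lam‖ ^ ((n : ℝ) / 2 - α) * constI n α θ ^ α := by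
  have hn' : (0 : ℝ) < n := by exact_mod_cast hn
  have hα₀ : 0 < α := by linarith [half_pos hn']
  have hlam₀ : lam ≠ 0 := by simpa using hlam 0 le_rfl
  have hint : 0 ≤ ∫ ξ, ‖resolventSymbol n lam ξ‖ ^ α :=
    integral_nonneg fun ξ => by positivity
  rw [(memLp_resolventSymbol hn hα hlam hθ₀ hθ₁ hθ).eLpNorm_eq_integral_rpow_norm
      (by simpa using hα₀) ENNReal.ofReal_ne_top, ENNReal.toReal_ofReal hα₀.le,
    ENNReal.toReal_ofReal (by positivity), ← Real.rpow_mul hint, inv_mul_cancel₀ hα₀.ne',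
    Real.rpow_one, integral_norm_resolventSymbol_rpow hn hα hlam₀ hθ₀ hθ₁ hθ]

end ResolventNorm

/-! ### Exponent bookkeeping and conclusion. -/

section Exponents

theorem fact_one_le_inv_ofReal {x : ℝ} (hx : x ≤ 1) : Fact (1 ≤ (ENNReal.ofReal x)⁻¹) :=
  ⟨ENNReal.one_le_inv.mpr (ENNReal.ofReal_le_one.mpr hx)⟩

theorem inv_ofReal_le_two {x : ℝ} (hx : 1 / 2 ≤ x) : (ENNReal.ofReal x)⁻¹ ≤ 2 := by
  rw [ENNReal.inv_le_iff_inv_le]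
  have h := ENNReal.ofReal_le_ofReal hx
  rwa [one_div, ENNReal.ofReal_inv_of_pos two_pos, ENNReal.ofReal_ofNat] at h

theorem holderTriple_inv_ofReal {x y z : ℝ} (hx : 0 ≤ x) (hy : 0 ≤ y) (h : x + y = z) :
    ENNReal.HolderTriple (ENNReal.ofReal x)⁻¹ (ENNReal.ofReal y)⁻¹ (ENNReal.ofReal z)⁻¹ :=
  ⟨by rw [inv_inv, inv_inv, inv_inv, ← ENNReal.ofReal_add hx hy, h]⟩

theorem holderConjugate_inv_ofReal {x y : ℝ} (hx : 0 ≤ x) (hy : 0 ≤ y) (h : x + y = 1) :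
    ENNReal.HolderConjugate (ENNReal.ofReal x)⁻¹ (ENNReal.ofReal y)⁻¹ := by
  rw [ENNReal.holderConjugate_iff, inv_inv, inv_inv, ← ENNReal.ofReal_add hx hy, h,
    ENNReal.ofReal_one]

theorem inv_ofReal_toReal_inv {p : ℝ≥0∞} (hp : 0 < p) : (ENNReal.ofReal p⁻¹.toReal)⁻¹ = p := by
  rw [ENNReal.ofReal_toReal (ENNReal.inv_ne_top.mpr hp.ne'), inv_inv]

/-- In reciprocals $R,S,P$ of $r,s,p$ the Hölder relations are linear: $1/\beta=R+P$,
$1/\beta'=1-R-P$, $1/\gamma=1+S-P$, $1/\gamma'=P-S$. Writing exponents as inverses of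
`ENNReal.ofReal` covers the value $\infty$ as reciprocal $0$. -/
theorem IsEigenvalue.one_le_eLpNorm_mul_of_bounds {n : ℕ} {p r s : ℝ≥0∞} [Fact (1 ≤ p)]
    {a b : Space n → ℂ} {lam : ℂ} (hp : p ≠ ∞) (hr : 0 < r) (hs : 0 < s)
    (hr₁ : 1 / 2 - p⁻¹.toReal ≤ r⁻¹.toReal) (hr₂ : r⁻¹.toReal ≤ 1 - p⁻¹.toReal)
    (hs₁ : -(1 / 2) + p⁻¹.toReal ≤ s⁻¹.toReal) (hs₂ : s⁻¹.toReal ≤ p⁻¹.toReal)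
    (ha : MemLp a r volume) (hb : MemLp b s volume) (hlam : ∀ t : ℝ, 0 ≤ t → lam ≠ t)
    (hm : MemLp (resolventSymbol n lam) (ENNReal.ofReal (r⁻¹.toReal + s⁻¹.toReal))⁻¹ volume)
    (h : IsEigenvalue (schrodingerOp p a b) lam) :
    1 ≤ (eLpNorm (resolventSymbol n lam) (ENNReal.ofReal (r⁻¹.toReal + s⁻¹.toReal))⁻¹
        volume).toReal * (eLpNorm a r volume).toReal * (eLpNorm b s volume).toReal := by
  have hp₀ : 0 < p := lt_of_lt_of_le one_pos Fact.out
  have hR : 0 ≤ r⁻¹.toReal := ENNReal.toReal_nonneg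
  have hS : 0 ≤ s⁻¹.toReal := ENNReal.toReal_nonneg
  have hP : 0 ≤ p⁻¹.toReal := ENNReal.toReal_nonneg
  have hr' := inv_ofReal_toReal_inv hr
  have hs' := inv_ofReal_toReal_inv hs
  have hp' := inv_ofReal_toReal_inv hp₀
  generalize r⁻¹.toReal = R at *
  generalize s⁻¹.toReal = S at *
  generalize p⁻¹.toReal = P at *
  subst hr' hs' hp'
  have : Fact (1 ≤ (ENNReal.ofReal (R + P))⁻¹) := fact_one_le_inv_ofReal (by linarith)
  have : Fact (1 ≤ (ENNReal.ofReal (1 - R - P))⁻¹) := fact_one_le_inv_ofReal (by linarith)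
  have : Fact (1 ≤ (ENNReal.ofReal (1 + S - P))⁻¹) := fact_one_le_inv_ofReal (by linarith)
  have : Fact (1 ≤ (ENNReal.ofReal (P - S))⁻¹) := fact_one_le_inv_ofReal (by linarith)
  have := holderTriple_inv_ofReal hR hP rfl
  have := holderConjugate_inv_ofReal (x := R + P) (y := 1 - R - P) (by linarith) (by linarith)
    (by ring)
  have := holderTriple_inv_ofReal (x := R + S) (y := 1 - R - P) (z := 1 + S - P) (by linarith)
    (by linarith) (by ring)
  have := holderConjugate_inv_ofReal (x := 1 + S - P) (y := P - S) (by linarith) (by linarith)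
    (by ring)
  have := holderTriple_inv_ofReal (x := S) (y := P - S) (z := P) hS (by linarith) (by ring)
  exact IsEigenvalue.one_le_eLpNorm_mul (β := (ENNReal.ofReal (R + P))⁻¹)
    (β' := (ENNReal.ofReal (1 - R - P))⁻¹) (γ := (ENNReal.ofReal (1 + S - P))⁻¹)
    (γ' := (ENNReal.ofReal (P - S))⁻¹) (inv_ofReal_le_two (by linarith))
    (inv_ofReal_le_two (by linarith)) hp ha hb hlam hm h

end Exponents

end Schrodinger

theorem mainTheorem9 (n : ℕ) (hn : 0 < n)
    (p r s : ℝ≥0∞) [Fact (1 ≤ p)] (hp : 1 < p) (hp' : p ≠ ∞) (hr : 0 < r) (hs : 0 < s)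
    (hrs : r ≠ ∞ ∨ s ≠ ∞)
    (hr₁ : 1 / 2 - p⁻¹.toReal ≤ r⁻¹.toReal) (hr₂ : r⁻¹.toReal ≤ 1 - p⁻¹.toReal)
    (hs₁ : -(1 / 2) + p⁻¹.toReal ≤ s⁻¹.toReal) (hs₂ : s⁻¹.toReal ≤ p⁻¹.toReal)
    (hrsn : r⁻¹.toReal + s⁻¹.toReal < 2 / (n : ℝ))
    (α : ℝ) (hα : α = (r⁻¹.toReal + s⁻¹.toReal)⁻¹)
    (a b : Schrodinger.Space n → ℂ) (ha : MemLp a r volume) (hb : MemLp b s volume)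
    (hMa : ∃ ν : ℝ, 0 < ν ∧ ν < p.toReal.conjExponent ∧
      Schrodinger.stummel ν p.toReal.conjExponent a < ∞)
    (hMb : ∃ μ : ℝ, 0 < μ ∧ μ < p.toReal ∧ Schrodinger.stummel μ p.toReal b < ∞)
    (hq : Tendsto (fun x : Schrodinger.Space n => ∫⁻ y in Metric.ball x 1, ‖a y * b y‖ₑ)
      (cocompact (Schrodinger.Space n)) (𝓝 0))
    (lam : ℂ) (hlam : ∀ t : ℝ, 0 ≤ t → lam ≠ t)
    (θ : ℝ) (hθ₀ : 0 < θ) (hθ₁ : θ < 2 * Real.pi)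
    (hθ : lam = ‖lam‖ * Complex.exp (θ * Complex.I))
    (heig : Schrodinger.IsEigenvalue (Schrodinger.schrodingerOp p a b) lam) :
    ‖lam‖ ^ (α - n / 2) ≤
      (4 * Real.pi) ^ (-(n : ℝ) / 2) * Schrodinger.constI n α θ ^ α *
        (eLpNorm a r volume).toReal ^ α * (eLpNorm b s volume).toReal ^ α := by
  have hn' : (0 : ℝ) < n := by exact_mod_cast hn
  have hinv : ∀ q : ℝ≥0∞, 0 < q → q ≠ ∞ → 0 < q⁻¹.toReal := fun q h₀ h₁ =>
    ENNReal.toReal_pos (ENNReal.inv_ne_zero.mpr h₁) (ENNReal.inv_ne_top.mpr h₀.ne')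
  have hx : 0 < r⁻¹.toReal + s⁻¹.toReal := by
    rcases hrs with h | h
    · exact add_pos_of_pos_of_nonneg (hinv r hr h) ENNReal.toReal_nonneg
    · exact add_pos_of_nonneg_of_pos ENNReal.toReal_nonneg (hinv s hs h)
  have hα₀ : 0 < α := hα ▸ inv_pos.mpr hx
  have hαn : (n : ℝ) / 2 < α := by
    rw [hα, ← inv_div]
    exact inv_strictAnti₀ hx hrsn
  have hlam₀ : 0 < ‖lam‖ := norm_pos_iff.mpr (by simpa using hlam 0 le_rfl)
  have hκ : (ENNReal.ofReal (r⁻¹.toReal + s⁻¹.toReal))⁻¹ = ENNReal.ofReal α := by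
    rw [hα, ENNReal.ofReal_inv_of_pos hx]
  have hone := heig.one_le_eLpNorm_mul_of_bounds hp' hr hs hr₁ hr₂ hs₁ hs₂ ha hb hlam
    (hκ ▸ Schrodinger.memLp_resolventSymbol hn hαn hlam hθ₀ hθ₁ hθ)
  rw [hκ] at hone
  -- Raising to the power $\alpha$ brings in the computed $\|m\|_\alpha^\alpha$; multiplying by
  -- $|\lambda|^{\alpha-n/2}$ gives the claim.
  have hpow := Real.one_le_rpow hone hα₀.le
  rw [Real.mul_rpow (by positivity) ENNReal.toReal_nonneg,
    Real.mul_rpow ENNReal.toReal_nonneg ENNReal.toReal_nonneg,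
    Schrodinger.eLpNorm_resolventSymbol_rpow hn hαn hlam hθ₀ hθ₁ hθ] at hpow
  have hcancel : ‖lam‖ ^ (α - n / 2) * ‖lam‖ ^ ((n : ℝ) / 2 - α) = 1 := by
    rw [← Real.rpow_add hlam₀, sub_add_sub_cancel', sub_self, Real.rpow_zero]
  calc ‖lam‖ ^ (α - n / 2) = ‖lam‖ ^ (α - n / 2) * 1 := (mul_one _).symm
    _ ≤ ‖lam‖ ^ (α - n / 2) * _ := mul_le_mul_of_nonneg_left hpow (by positivity)
    _ = (‖lam‖ ^ (α - n / 2) * ‖lam‖ ^ ((n : ℝ) / 2 - α)) *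
        ((4 * Real.pi) ^ (-(n : ℝ) / 2) * Schrodinger.constI n α θ ^ α *
          (eLpNorm a r volume).toReal ^ α * (eLpNorm b s volume).toReal ^ α) := by ring
    _ = _ := by rw [hcancel, one_mul]
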